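/- All graphs are finite and undirected, without loops or multiple edges. Let $G$ and $H$ be graphs, and put $P := V(G)\times V(H)$; write $gh$ for a pair $(g,h)\in P$. A subset $I\subseteq P$ is called a partial isomorphism if for all $gh, g'h'\in I$ one has $g=g' \Leftrightarrow h=h'$ and $gg'\in E(G)\Leftrightarrow hh'\in E(H)$. For $t\ge 1$, the level-$t$ Lasserre relaxation for isomorphism of $G$ and $H$ is the system in real variables $y_I$, for $I\subseteq P$ with $|I|\le 2t$, with constraints $$(y_{I\cup J})_{I,J\subseteq P,\ |I|,|J|\le t}\succeq 0,$$ $$\sum_{h\in V(H)} y_{I\cup\{gh\}} = y_I \quad\text{for all } I\subseteq P \text{ with } |I|\le 2t-2 \text{ and all } g\in V(G),$$ $$\sum_{g\in V(G)} y_{I\cup\{gh\}} = y_I \quad\text{for all } I\subseteq P \text{ with } |I|\le 2t-2 \text{ and all } h\in V(H),$$ $$y_I = 0 \quad\text{for all } I\subseteq P \text{ with } |I|\le 2t \text{ that are not partial isomorphisms},\qquad y_\emptyset = 1.$$ Write $G\simeq_t^{\mathrm{L}} H$ if this system has a solution. A graph is outerplanar if it has neither $K_4$ nor $K_{2,3}$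 as a minor. Let $\hom(F,G)$ denote the number of graph homomorphisms from $F$ to $G$. **Theorem.** Any two graphs $G$ and $H$ satisfy $G\simeq_1^{\mathrm{L}} H$ if and only if $\hom(F,G)=\hom(F,H)$ for every outerplanar graph $F$, that is, if and only if $G$ and $H$ are homomorphism indistinguishable over the class of outerplanar graphs. -/

import Mathlib

namespace LasserreIso

section Lasserre

variable {V W : Type*}

/-- A set of vertex pairs `{g₁h₁, …, gₗhₗ}` is a partial isomorphism from `G` to `H` if for all
of its elements `gᵢhᵢ`, `gⱼhⱼ` one has `gᵢ = gⱼ ↔ hᵢ = hⱼ`, and `gᵢgⱼ` is an edge of `G` iff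
`hᵢhⱼ` is an edge of `H`. -/
def IsPartialIso (G : SimpleGraph V) (H : SimpleGraph W) (I : Finset (V × W)) : Prop :=
  ∀ p ∈ I, ∀ q ∈ I, (p.1 = q.1 ↔ p.2 = q.2) ∧ (G.Adj p.1 q.1 ↔ H.Adj p.2 q.2)

/-- The moment matrix `M_t(y) = (y_{I ∪ J})`, whose rows and columns are indexed by the subsets
of `V × W` of size at most `t`. -/
def momentMatrix [DecidableEq V] [DecidableEq W] (t : ℕ) (y : Finset (V × W) → ℝ) :
    Matrix {I : Finset (V × W) // I.card ≤ t} {I : Finset (V × W) // I.card ≤ t} ℝ :=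
  Matrix.of fun I J => y (I.1 ∪ J.1)

/-- `y` is a solution of the level-`t` Lasserre relaxation for graph isomorphism (for `t ≥ 1`).
The variables of the system are the `y I` with `I.card ≤ 2 * t`; the values of `y` on larger sets
occur in none of the constraints. -/
structure IsLasserreSolution [Fintype V] [DecidableEq V] [Fintype W] [DecidableEq W]
    (t : ℕ) (G : SimpleGraph V) (H : SimpleGraph W) (y : Finset (V × W) → ℝ) : Prop where
  posSemidef : (momentMatrix t y).PosSemidef
  sum_right : ∀ I : Finset (V × W), I.card + 2 ≤ 2 * t → ∀ g : V,
    ∑ h : W, y (I ∪ {(g, h)}) = y I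
  sum_left : ∀ I : Finset (V × W), I.card + 2 ≤ 2 * t → ∀ h : W,
    ∑ g : V, y (I ∪ {(g, h)}) = y I
  eq_zero : ∀ I : Finset (V × W), I.card ≤ 2 * t → ¬ IsPartialIso G H I → y I = 0
  empty : y ∅ = 1

/-- The level-`t` Lasserre relaxation for isomorphism of `G` and `H` is feasible. -/
def LasserreFeasible [Fintype V] [DecidableEq V] [Fintype W] [DecidableEq W]
    (t : ℕ) (G : SimpleGraph V) (H : SimpleGraph W) : Prop :=
  ∃ y : Finset (V × W) → ℝ, IsLasserreSolution t G H y

end Lasserre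

section Graphs

/-- `K` is a minor of `F`: there are pairwise disjoint connected (in particular non-empty) sets
of vertices of `F`, one for each vertex of `K`, such that the sets belonging to adjacent vertices
of `K` are joined by an edge of `F`. -/
def IsMinor {U V : Type*} (K : SimpleGraph U) (F : SimpleGraph V) : Prop :=
  ∃ B : U → Set V,
    (∀ u, (F.induce (B u)).Connected) ∧
    (∀ u u', u ≠ u' → Disjoint (B u) (B u')) ∧
    ∀ u u', K.Adj u u' → ∃ x ∈ B u, ∃ x' ∈ B u', F.Adj x x'

/-- A graph is outerplanar if it has neither `K₄` nor `K₂,₃` as a minor. -/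
def IsOuterplanar {V : Type*} (F : SimpleGraph V) : Prop :=
  ¬ IsMinor (SimpleGraph.completeGraph (Fin 4)) F ∧
    ¬ IsMinor (completeBipartiteGraph (Fin 2) (Fin 3)) F

/-- `G` and `H` are homomorphism indistinguishable over the class `𝓕`: every finite graph `F`
in `𝓕` has equally many homomorphisms to `G` and to `H`. -/
def HomIndistinguishable {V W : Type*} (𝓕 : ∀ U : Type, SimpleGraph U → Prop)
    (G : SimpleGraph V) (H : SimpleGraph W) : Prop :=
  ∀ (U : Type) [Finite U] (F : SimpleGraph U), 𝓕 U F → Nat.card (F →g G) = Nat.card (F →g H)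

/-- The class of outerplanar graphs. -/
def outerplanarGraphs : ∀ U : Type, SimpleGraph U → Prop := fun _ F => IsOuterplanar F

end Graphs

end LasserreIso

/-! Both sides are equivalent to a third condition: `entrySum X = entrySum Y` for all `MatrixPair G
H X Y`, where the same expression in the all-ones matrix `J`, matrix product and entrywise product
with the identity and the adjacency matrix is evaluated in both graphs.

A Lasserre solution is a Gram matrix. The coordinates of its vectors form matrices `K k` for which
`X ↦ ∑ k, (K k)ᵀ * X * K k` is a unital, trace-preserving, completely positive map, and the
vanishing constraints make it respect the entrywise products. Hence `X * K k = K k * Y` for all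
pairs (`MatrixPair.mul_eq_mul`), and entry sums, being traces of `X * J`, agree. Conversely, if
entry sums agree, the span of the pairs is the graph of an isometry for the trace form. For a basis
`b` with orthonormal first components, the matrix `∑ i, (b i).1 ⊗ₖ (b i).2` is positive semidefinite
(`posSemidef_sum_kronecker`), and its entries give a solution.

Each expression counts homomorphisms from a graph with two labelled vertices. Products glue in
series, the entrywise products identify or join the labels, so no two edges cross when the vertices
are placed on a line; such graphs and their contractions are outerplanar
(`MatrixPair.exists_noncrossing`, `IsNoncrossing.isOuterplanar`). Conversely, an outerplanar graph
is decomposed along cut vertices (`matrixPair_homMatrix`). The labels `a`, `b` admitted are those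
without `HasTheta`: a theta together with a new path of length two from `a` to `b` would contain
`K₂,₃`. Every vertex has such a partner (`IsOuterplanar.exists_not_hasTheta`). -/

namespace LasserreIso

open Matrix

/-! ### From a Lasserre solution to equal entry sums: intertwining matrices. -/

section Algebra

variable {V W : Type*} [Fintype V] [DecidableEq V] [Fintype W] [DecidableEq W]

/-- The all-ones matrix. -/
def onesMatrix (n : Type*) : Matrix n n ℝ := Matrix.of fun _ _ => 1

@[simp]
theorem onesMatrix_apply {n : Type*} (u v : n) : onesMatrix n u v = 1 := rfl

/-- The pairs of matrices obtained by evaluating the same expression, built from the all-ones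
matrix by matrix multiplication and by entrywise multiplication with the identity matrix and with
the adjacency matrix, in two graphs `G` and `H`. -/
inductive MatrixPair (G : SimpleGraph V) (H : SimpleGraph W) [DecidableRel G.Adj]
    [DecidableRel H.Adj] : Matrix V V ℝ → Matrix W W ℝ → Prop
  | ones : MatrixPair G H (onesMatrix V) (onesMatrix W)
  | mul {X X' : Matrix V V ℝ} {Y Y' : Matrix W W ℝ} :
      MatrixPair G H X Y → MatrixPair G H X' Y' → MatrixPair G H (X * X') (Y * Y')
  | hadamard_one {X : Matrix V V ℝ} {Y : Matrix W W ℝ} :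
      MatrixPair G H X Y → MatrixPair G H (1 ⊙ X) (1 ⊙ Y)
  | hadamard_adjMatrix {X : Matrix V V ℝ} {Y : Matrix W W ℝ} :
      MatrixPair G H X Y → MatrixPair G H (G.adjMatrix ℝ ⊙ X) (H.adjMatrix ℝ ⊙ Y)

/-- The sum of the entries of a square matrix. -/
def entrySum {n : Type*} [Fintype n] (X : Matrix n n ℝ) : ℝ := ∑ u, ∑ v, X u v

theorem trace_mul_onesMatrix {n : Type*} [Fintype n] (X : Matrix n n ℝ) :
    (X * onesMatrix n).trace = entrySum X := by
  simp [Matrix.trace, Matrix.mul_apply, entrySum]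

section Intertwiner

variable {κ : Type*} [Fintype κ] {K : κ → Matrix V W ℝ}

theorem sum_transpose_mul_mul_apply {V W κ : Type*} [Fintype V] [Fintype κ]
    {K : κ → Matrix V W ℝ} (X : Matrix V V ℝ) (h h' : W) :
    (∑ k, (K k)ᵀ * X * K k) h h' = ∑ g, ∑ g', X g g' * ∑ k, K k g h * K k g' h' := by
  simp only [Matrix.sum_apply, Matrix.mul_apply, Matrix.transpose_apply, Finset.sum_mul,
    Finset.mul_sum]
  conv_lhs => enter [2, k]; rw [Finset.sum_comm]
  rw [Finset.sum_comm]
  refine Finset.sum_congr rfl fun g _ => ?_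
  rw [Finset.sum_comm]
  exact Finset.sum_congr rfl fun g' _ => Finset.sum_congr rfl fun k _ => by ring

theorem sum_mul_mul_transpose_apply {V W κ : Type*} [Fintype W] [Fintype κ]
    {K : κ → Matrix V W ℝ} (Y : Matrix W W ℝ) (g g' : V) :
    (∑ k, K k * Y * (K k)ᵀ) g g' = ∑ h, ∑ h', Y h h' * ∑ k, K k g h * K k g' h' := by
  simpa using sum_transpose_mul_mul_apply (K := fun k => (K k)ᵀ) Y g g'

/-- The squared Frobenius norms of `X * K k - K k * Y` sum to zero: after expansion the four terms
become `tr XᵀX - tr XᵀX - tr YᵀY + tr YᵀY`. -/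
theorem mul_eq_mul_of_sum_eq (h1 : ∑ k, (K k)ᵀ * K k = 1) (h2 : ∑ k, K k * (K k)ᵀ = 1)
    {X : Matrix V V ℝ} {Y : Matrix W W ℝ} (hX : ∑ k, (K k)ᵀ * X * K k = Y)
    (hY : ∑ k, K k * Y * (K k)ᵀ = X) (k : κ) : X * K k = K k * Y := by
  have key : ∑ k, ((X * K k - K k * Y)ᴴ * (X * K k - K k * Y)).trace = 0 := by
    have e : ∀ k, ((X * K k - K k * Y)ᴴ * (X * K k - K k * Y)).trace =
        (Xᵀ * X * (K k * (K k)ᵀ)).trace - (Xᵀ * (K k * Y * (K k)ᵀ)).trace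
          - (Yᵀ * ((K k)ᵀ * X * K k)).trace + (Yᵀ * ((K k)ᵀ * K k) * Y).trace := by
      intro k
      simp only [conjTranspose_eq_transpose_of_trivial, transpose_sub, transpose_mul,
        Matrix.sub_mul, Matrix.mul_sub, trace_sub]
      have a1 : ((K k)ᵀ * Xᵀ * (X * K k)).trace = (Xᵀ * X * (K k * (K k)ᵀ)).trace := by
        rw [Matrix.mul_assoc, Matrix.trace_mul_comm]; simp only [Matrix.mul_assoc]
      have a2 : ((K k)ᵀ * Xᵀ * (K k * Y)).trace = (Xᵀ * (K k * Y * (K k)ᵀ)).trace := by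
        rw [Matrix.mul_assoc, Matrix.trace_mul_comm]; simp only [Matrix.mul_assoc]
      have a3 : (Yᵀ * (K k)ᵀ * (X * K k)).trace = (Yᵀ * ((K k)ᵀ * X * K k)).trace := by
        simp only [Matrix.mul_assoc]
      have a4 : (Yᵀ * (K k)ᵀ * (K k * Y)).trace = (Yᵀ * ((K k)ᵀ * K k) * Y).trace := by
        simp only [Matrix.mul_assoc]
      rw [a1, a2, a3, a4]; ring
    simp only [e, Finset.sum_add_distrib, Finset.sum_sub_distrib, ← Matrix.trace_sum,
      ← Matrix.mul_sum, ← Matrix.sum_mul, h1, h2, hX, hY, Matrix.mul_one]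
    ring
  have nn : ∀ k ∈ Finset.univ, 0 ≤ ((X * K k - K k * Y)ᴴ * (X * K k - K k * Y)).trace :=
    fun k _ => (posSemidef_conjTranspose_mul_self _).trace_nonneg
  have := (Finset.sum_eq_zero_iff_of_nonneg nn).1 key k (Finset.mem_univ k)
  rw [trace_conjTranspose_mul_self_eq_zero_iff, sub_eq_zero] at this
  exact this

theorem sum_eq_of_mul_eq_mul (h1 : ∑ k, (K k)ᵀ * K k = 1) (h2 : ∑ k, K k * (K k)ᵀ = 1)
    {X : Matrix V V ℝ} {Y : Matrix W W ℝ} (h : ∀ k, X * K k = K k * Y) :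
    ∑ k, (K k)ᵀ * X * K k = Y ∧ ∑ k, K k * Y * (K k)ᵀ = X := by
  constructor
  · simp only [Matrix.mul_assoc, h]
    simp only [← Matrix.mul_assoc, ← Matrix.sum_mul, h1, Matrix.one_mul]
  · simp only [← h]
    simp only [Matrix.mul_assoc, ← Matrix.mul_sum, h2, Matrix.mul_one]

/-- The map `X ↦ ∑ k, (K k)ᵀ * X * K k` has kernel `∑ k, K k g h * K k g' h'`, which lives where `M
g g' = N h h'`. So it takes `M ⊙ X` to `N ⊙ Y`, its adjoint goes back, and `mul_eq_mul_of_sum_eq`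
returns to intertwining. -/
theorem hadamard_mul_eq_mul (h1 : ∑ k, (K k)ᵀ * K k = 1) (h2 : ∑ k, K k * (K k)ᵀ = 1)
    {M : Matrix V V ℝ} {N : Matrix W W ℝ}
    (hMN : ∀ g g' h h', M g g' ≠ N h h' → ∑ k, K k g h * K k g' h' = 0)
    {X : Matrix V V ℝ} {Y : Matrix W W ℝ} (h : ∀ k, X * K k = K k * Y) (k : κ) :
    (M ⊙ X) * K k = K k * (N ⊙ Y) := by
  obtain ⟨hX, hY⟩ := sum_eq_of_mul_eq_mul h1 h2 h
  have hMN' : ∀ g g' h h', M g g' * ∑ k, K k g h * K k g' h' =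
      N h h' * ∑ k, K k g h * K k g' h' := by
    intro g g' h h'
    by_cases he : M g g' = N h h'
    · rw [he]
    · rw [hMN _ _ _ _ he]; simp
  refine mul_eq_mul_of_sum_eq h1 h2 ?_ ?_ k
  · ext w w'
    rw [sum_transpose_mul_mul_apply, hadamard_apply, ← hX, sum_transpose_mul_mul_apply,
      Finset.mul_sum]
    refine Finset.sum_congr rfl fun g _ => ?_
    rw [Finset.mul_sum]
    refine Finset.sum_congr rfl fun g' _ => ?_
    rw [hadamard_apply, mul_comm (M g g'), mul_assoc, hMN']; ring
  · ext w w'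
    rw [sum_mul_mul_transpose_apply, hadamard_apply, ← hY, sum_mul_mul_transpose_apply,
      Finset.mul_sum]
    refine Finset.sum_congr rfl fun g _ => ?_
    rw [Finset.mul_sum]
    refine Finset.sum_congr rfl fun g' _ => ?_
    rw [hadamard_apply, mul_comm (N g g'), mul_assoc, ← hMN']; ring

end Intertwiner

variable {G : SimpleGraph V} {H : SimpleGraph W} [DecidableRel G.Adj] [DecidableRel H.Adj]

theorem MatrixPair.mul_eq_mul {κ : Type*} [Fintype κ] {K : κ → Matrix V W ℝ}
    (h1 : ∑ k, (K k)ᵀ * K k = 1) (h2 : ∑ k, K k * (K k)ᵀ = 1)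
    (hJ : ∀ k, onesMatrix V * K k = K k * onesMatrix W)
    (heq : ∀ g g' h h', ¬ (g = g' ↔ h = h') → ∑ k, K k g h * K k g' h' = 0)
    (hadj : ∀ g g' h h', ¬ (G.Adj g g' ↔ H.Adj h h') → ∑ k, K k g h * K k g' h' = 0)
    {X : Matrix V V ℝ} {Y : Matrix W W ℝ} (hXY : MatrixPair G H X Y) :
    ∀ k, X * K k = K k * Y := by
  induction hXY with
  | ones => exact hJ
  | mul _ _ ih ih' =>
    intro k
    rw [Matrix.mul_assoc, ih', ← Matrix.mul_assoc, ih, Matrix.mul_assoc]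
  | hadamard_one _ ih =>
    refine hadamard_mul_eq_mul h1 h2 (fun g g' h h' hne => heq g g' h h' fun hiff => hne ?_) ih
    simp only [Matrix.one_apply, hiff]
  | hadamard_adjMatrix _ ih =>
    refine hadamard_mul_eq_mul h1 h2 (fun g g' h h' hne => hadj g g' h h' fun hiff => hne ?_) ih
    simp only [SimpleGraph.adjMatrix_apply, hiff]

/-- Expanding, `‖∑ i, w i - v‖² = 1 - 2 * 1 + 1 = 0`. -/
theorem sum_eq_of_orthogonal {ι κ : Type*} [Fintype ι] [Fintype κ] {w : ι → κ → ℝ} {v : κ → ℝ}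
    (hv : ∑ k, v k * v k = 1) (hw : ∀ i j, i ≠ j → ∑ k, w i k * w j k = 0)
    (hvw : ∀ i, ∑ k, v k * w i k = ∑ k, w i k * w i k) (hsum : ∑ i, ∑ k, w i k * w i k = 1)
    (k : κ) : ∑ i, w i k = v k := by
  have h0 : ∑ k, (∑ i, w i k - v k) ^ 2 = 0 := by
    have e : ∀ k, (∑ i, w i k - v k) ^ 2 =
        ∑ i, ∑ j, w i k * w j k - 2 * ∑ i, v k * w i k + v k * v k := by
      intro k
      rw [← Finset.sum_mul_sum, ← Finset.mul_sum]; ring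
    have e1 : ∑ k, ∑ i, ∑ j, w i k * w j k = 1 := by
      rw [Finset.sum_comm, ← hsum]
      refine Finset.sum_congr rfl fun i _ => ?_
      rw [Finset.sum_comm, Finset.sum_eq_single i (fun j _ hj => hw i j hj.symm) (by simp)]
    have e2 : ∑ k, ∑ i, v k * w i k = 1 := by
      rw [Finset.sum_comm, ← hsum]
      exact Finset.sum_congr rfl fun i _ => hvw i
    simp only [e, Finset.sum_add_distrib, Finset.sum_sub_distrib,
      ← Finset.mul_sum Finset.univ _ (2 : ℝ), hv, e1, e2]
    norm_num
  have := (Finset.sum_eq_zero_iff_of_nonneg fun k _ => sq_nonneg _).1 h0 k (Finset.mem_univ k)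
  rwa [sq_eq_zero_iff, sub_eq_zero] at this

open scoped MatrixOrder in
theorem exists_gram {n : Type*} [Fintype n] {M : Matrix n n ℝ} (hM : M.PosSemidef) :
    ∃ N : Matrix n n ℝ, ∀ i j, M i j = ∑ k, N k i * N k j := by
  classical
  obtain ⟨N, hN⟩ := CStarAlgebra.nonneg_iff_eq_star_mul_self.mp hM.nonneg
  refine ⟨N, fun i j => ?_⟩
  rw [hN]
  simp [Matrix.mul_apply, Matrix.star_apply]

theorem LasserreFeasible.entrySum_eq (hf : LasserreFeasible 1 G H)
    {X : Matrix V V ℝ} {Y : Matrix W W ℝ} (hXY : MatrixPair G H X Y) :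
    entrySum X = entrySum Y := by
  obtain ⟨y, hy⟩ := hf
  obtain ⟨N, hN⟩ := exists_gram hy.posSemidef
  let e : {I : Finset (V × W) // I.card ≤ 1} := ⟨∅, by simp⟩
  let s : V × W → {I : Finset (V × W) // I.card ≤ 1} := fun p => ⟨{p}, by simp⟩
  -- The Gram vectors of the singletons, read one coordinate at a time: the coordinate `k` yields a
  -- matrix indexed by `V` and `W`.
  let K : {I : Finset (V × W) // I.card ≤ 1} → Matrix V W ℝ := fun k => Matrix.of fun g h =>
    N k (s (g, h))
  have hss : ∀ g g' h h', ∑ k, K k g h * K k g' h' = y ({(g, h)} ∪ {(g', h')}) := fun g g' h h' =>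
    (hN (s (g, h)) (s (g', h'))).symm
  have hes : ∀ g h, ∑ k, N k e * K k g h = y {(g, h)} := fun g h => by
    rw [← Finset.empty_union {(g, h)}]; exact (hN e (s (g, h))).symm
  have hee : ∑ k, N k e * N k e = 1 := by
    rw [← hy.empty]; exact (hN e e).symm
  have hzero : ∀ g g' h h', ¬ ((g = g' ↔ h = h') ∧ (G.Adj g g' ↔ H.Adj h h')) →
      ∑ k, K k g h * K k g' h' = 0 := by
    intro g g' h h' hne
    rw [hss]
    refine hy.eq_zero _ ((Finset.card_union_le _ _).trans (by simp)) fun hp => hne ?_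
    exact hp (g, h) (by simp) (g', h') (by simp)
  have hdiag : ∀ g h, ∑ k, K k g h * K k g h = y {(g, h)} := fun g h => by rw [hss]; simp
  have hright : ∀ g, ∑ h, y {(g, h)} = 1 := fun g => by
    rw [← hy.empty, ← hy.sum_right ∅ (by simp) g]; simp
  have hleft : ∀ h, ∑ g, y {(g, h)} = 1 := fun h => by
    rw [← hy.empty, ← hy.sum_left ∅ (by simp) h]; simp
  -- The vectors of the pairs in one column are orthogonal and sum to the vector of `∅`; the same
  -- holds for rows. All row and column sums of `K k` thus coincide, which is commutation with the
  -- all-ones matrix.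
  have hcol : ∀ h k, ∑ g, K k g h = N k e := fun h => by
    refine sum_eq_of_orthogonal (w := fun g k => K k g h) hee
      (fun g g' hne => hzero _ _ _ _ fun hp => hne (hp.1.2 rfl)) (fun g => ?_) ?_
    · rw [hes, hdiag]
    · simp only [hdiag, hleft]
  have hrow : ∀ g k, ∑ h, K k g h = N k e := fun g => by
    refine sum_eq_of_orthogonal (w := fun h k => K k g h) hee
      (fun h h' hne => hzero _ _ _ _ fun hp => hne (hp.1.1 rfl)) (fun h => ?_) ?_
    · rw [hes, hdiag]
    · simp only [hdiag, hright]
  have h1 : ∑ k, (K k)ᵀ * K k = 1 := by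
    ext h h'
    simp only [Matrix.sum_apply, Matrix.mul_apply, Matrix.transpose_apply]
    rw [Finset.sum_comm]
    by_cases hh : h = h'
    · subst hh
      simp only [hdiag, hleft, Matrix.one_apply_eq]
    · rw [Matrix.one_apply_ne hh]
      exact Finset.sum_eq_zero fun g _ => hzero _ _ _ _ fun hp => hh (hp.1.1 rfl)
  have h2 : ∑ k, K k * (K k)ᵀ = 1 := by
    ext g g'
    simp only [Matrix.sum_apply, Matrix.mul_apply, Matrix.transpose_apply]
    rw [Finset.sum_comm]
    by_cases hh : g = g'
    · subst hh
      simp only [hdiag, hright, Matrix.one_apply_eq]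
    · rw [Matrix.one_apply_ne hh]
      exact Finset.sum_eq_zero fun h _ => hzero _ _ _ _ fun hp => hh (hp.1.2 rfl)
  have hJ : ∀ k, onesMatrix V * K k = K k * onesMatrix W := by
    intro k
    ext g h
    rw [Matrix.mul_apply, Matrix.mul_apply]
    simp only [onesMatrix_apply, one_mul, mul_one]
    rw [hcol, hrow]
  -- The extra factor turns the entry sum into a trace, which the map preserves because `∑ k, K k *
  -- (K k)ᵀ = 1`.
  have hXJ := (hXY.mul .ones).mul_eq_mul h1 h2 hJ
    (fun g g' h h' hne => hzero _ _ _ _ fun hp => hne hp.1)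
    (fun g g' h h' hne => hzero _ _ _ _ fun hp => hne hp.2)
  have hY := (sum_eq_of_mul_eq_mul h1 h2 hXJ).1
  have htr : ∀ k, ((K k)ᵀ * (X * onesMatrix V) * K k).trace =
      (X * onesMatrix V * (K k * (K k)ᵀ)).trace := fun k => by
    rw [Matrix.mul_assoc, Matrix.trace_mul_comm, Matrix.mul_assoc]
  rw [← trace_mul_onesMatrix, ← trace_mul_onesMatrix, ← hY, Matrix.trace_sum]
  simp only [htr]
  rw [← Matrix.trace_sum, ← Matrix.mul_sum, h2, Matrix.mul_one]

end Algebra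

/-! ### The span of the matrix pairs as the graph of an isometry. -/

section Converse

variable {V W : Type*} [Fintype V] [DecidableEq V] [Fintype W] [DecidableEq W]

theorem trace_transpose_mul_eq_entrySum {n : Type*} [Fintype n] [DecidableEq n]
    (X Y : Matrix n n ℝ) :
    (Xᵀ * Y).trace = ∑ u, ∑ v, X u v * Y u v := by
  simp only [Matrix.trace, Matrix.mul_apply, Matrix.diag_apply, Matrix.transpose_apply]
  exact Finset.sum_comm

theorem one_hadamard_entrySum {n : Type*} [Fintype n] [DecidableEq n] (X : Matrix n n ℝ) :
    entrySum (1 ⊙ X) = X.trace := by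
  simp [entrySum, Matrix.hadamard_apply, Matrix.one_apply, Matrix.trace]

variable (G : SimpleGraph V) (H : SimpleGraph W) [DecidableRel G.Adj] [DecidableRel H.Adj]

theorem MatrixPair.transpose {G : SimpleGraph V} {H : SimpleGraph W} [DecidableRel G.Adj]
    [DecidableRel H.Adj] {X : Matrix V V ℝ} {Y : Matrix W W ℝ} (h : MatrixPair G H X Y) :
    MatrixPair G H Xᵀ Yᵀ := by
  induction h with
  | ones => exact .ones
  | mul _ _ ih ih' => rw [transpose_mul, transpose_mul]; exact ih'.mul ih
  | @hadamard_one X Y _ ih =>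
    have e1 : (1 ⊙ X)ᵀ = 1 ⊙ Xᵀ := by
      ext i j; simp [Matrix.hadamard_apply, Matrix.one_apply, eq_comm]
    have e2 : (1 ⊙ Y)ᵀ = 1 ⊙ Yᵀ := by
      ext i j; simp [Matrix.hadamard_apply, Matrix.one_apply, eq_comm]
    rw [e1, e2]; exact ih.hadamard_one
  | @hadamard_adjMatrix X Y _ ih =>
    have e1 : (G.adjMatrix ℝ ⊙ X)ᵀ = G.adjMatrix ℝ ⊙ Xᵀ := by
      ext i j; simp [Matrix.hadamard_apply, G.adj_comm]
    have e2 : (H.adjMatrix ℝ ⊙ Y)ᵀ = H.adjMatrix ℝ ⊙ Yᵀ := by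
      ext i j; simp [Matrix.hadamard_apply, H.adj_comm]
    rw [e1, e2]; exact ih.hadamard_adjMatrix

/-- The linear span of the matrix pairs. -/
def pairSpan : Submodule ℝ (Matrix V V ℝ × Matrix W W ℝ) :=
  Submodule.span ℝ {z | MatrixPair G H z.1 z.2}

variable {G H}

theorem MatrixPair.mem_pairSpan {X : Matrix V V ℝ} {Y : Matrix W W ℝ} (h : MatrixPair G H X Y) :
    (X, Y) ∈ pairSpan G H := Submodule.subset_span h

theorem pairSpan_map (L : Matrix V V ℝ × Matrix W W ℝ →ₗ[ℝ] Matrix V V ℝ × Matrix W W ℝ)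
    (hL : ∀ z : Matrix V V ℝ × Matrix W W ℝ, MatrixPair G H z.1 z.2 → L z ∈ pairSpan G H)
    {z : Matrix V V ℝ × Matrix W W ℝ} (hz : z ∈ pairSpan G H) : L z ∈ pairSpan G H := by
  have : pairSpan G H ≤ (pairSpan G H).comap L := Submodule.span_le.2 fun z hz => hL z hz
  exact this hz

theorem pairSpan_transpose {z : Matrix V V ℝ × Matrix W W ℝ} (hz : z ∈ pairSpan G H) :
    (z.1ᵀ, z.2ᵀ) ∈ pairSpan G H :=
  pairSpan_map (LinearMap.prodMap (transposeLinearEquiv V V ℝ ℝ).toLinearMap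
    (transposeLinearEquiv W W ℝ ℝ).toLinearMap) (fun _ h => h.transpose.mem_pairSpan) hz

theorem pairSpan_hadamard_one {z : Matrix V V ℝ × Matrix W W ℝ} (hz : z ∈ pairSpan G H) :
    (1 ⊙ z.1, 1 ⊙ z.2) ∈ pairSpan G H :=
  pairSpan_map
    { toFun := fun z => (1 ⊙ z.1, 1 ⊙ z.2)
      map_add' := fun z z' => by simp [Matrix.hadamard_add]
      map_smul' := fun c z => by simp [Matrix.hadamard_smul] }
    (fun _ h => h.hadamard_one.mem_pairSpan) hz

theorem pairSpan_hadamard_adjMatrix {z : Matrix V V ℝ × Matrix W W ℝ}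
    (hz : z ∈ pairSpan G H) :
    (G.adjMatrix ℝ ⊙ z.1, H.adjMatrix ℝ ⊙ z.2) ∈ pairSpan G H :=
  pairSpan_map
    { toFun := fun z => (G.adjMatrix ℝ ⊙ z.1, H.adjMatrix ℝ ⊙ z.2)
      map_add' := fun z z' => by simp [Matrix.hadamard_add]
      map_smul' := fun c z => by simp [Matrix.hadamard_smul] }
    (fun _ h => h.hadamard_adjMatrix.mem_pairSpan) hz

theorem pairSpan_mul {z z' : Matrix V V ℝ × Matrix W W ℝ} (hz : z ∈ pairSpan G H)
    (hz' : z' ∈ pairSpan G H) : (z.1 * z'.1, z.2 * z'.2) ∈ pairSpan G H := by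
  refine pairSpan_map (LinearMap.mulRight ℝ z') (fun w hw => ?_) hz
  exact pairSpan_map (LinearMap.mulLeft ℝ w) (fun w' hw' => (hw.mul hw').mem_pairSpan) hz'

theorem one_hadamard_onesMatrix (n : Type*) [DecidableEq n] :
    (1 : Matrix n n ℝ) ⊙ onesMatrix n = 1 := by
  ext i j; simp [Matrix.hadamard_apply]

theorem pairSpan_one : ((1 : Matrix V V ℝ), (1 : Matrix W W ℝ)) ∈ pairSpan G H := by
  have := (MatrixPair.ones (G := G) (H := H)).hadamard_one.mem_pairSpan
  rwa [one_hadamard_onesMatrix, one_hadamard_onesMatrix] at this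

theorem pairSpan_entrySum (hsum : ∀ X Y, MatrixPair G H X Y → entrySum X = entrySum Y)
    {z : Matrix V V ℝ × Matrix W W ℝ} (hz : z ∈ pairSpan G H) :
    entrySum z.1 = entrySum z.2 := by
  induction hz using Submodule.span_induction with
  | mem z hz => exact hsum _ _ hz
  | zero => simp [entrySum]
  | add x y _ _ hx hy =>
    simp only [entrySum, Prod.fst_add, Prod.snd_add, Matrix.add_apply, Finset.sum_add_distrib]
      at hx hy ⊢
    rw [hx, hy]
  | smul c x _ hx =>
    simp only [entrySum, Prod.smul_fst, Prod.smul_snd, Matrix.smul_apply, smul_eq_mul,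
      ← Finset.mul_sum] at hx ⊢
    rw [hx]

theorem pairSpan_trace (hsum : ∀ X Y, MatrixPair G H X Y → entrySum X = entrySum Y)
    {z : Matrix V V ℝ × Matrix W W ℝ} (hz : z ∈ pairSpan G H) :
    z.1.trace = z.2.trace := by
  rw [← one_hadamard_entrySum, ← one_hadamard_entrySum]
  exact pairSpan_entrySum hsum (pairSpan_hadamard_one hz)

/-- The span is closed under transposes and products, and a trace is the entry sum of the product
with the identity. So passing from first to second components preserves the Frobenius inner product.
-/
theorem pairSpan_trace_transpose_mul
    (hsum : ∀ X Y, MatrixPair G H X Y → entrySum X = entrySum Y)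
    {z z' : Matrix V V ℝ × Matrix W W ℝ}
    (hz : z ∈ pairSpan G H) (hz' : z' ∈ pairSpan G H) :
    (z.1ᵀ * z'.1).trace = (z.2ᵀ * z'.2).trace :=
  pairSpan_trace hsum (pairSpan_mul (pairSpan_transpose hz) hz')

/-- The first component determines an element of the span, since both components have the same norm.
An orthonormal basis of the space of first components therefore lifts to the span, with the usual
Fourier coefficients. -/
theorem exists_pairSpan_expansion
    (hsum : ∀ X Y, MatrixPair G H X Y → entrySum X = entrySum Y) :
    ∃ (ι : Type) (_ : Fintype ι) (b : ι → Matrix V V ℝ × Matrix W W ℝ),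
      (∀ i, b i ∈ pairSpan G H) ∧
      ∀ z ∈ pairSpan G H, z = ∑ i, ((b i).1ᵀ * z.1).trace • b i := by
  let E := EuclideanSpace ℝ (V × V)
  let f : Matrix V V ℝ × Matrix W W ℝ →ₗ[ℝ] E :=
    { toFun := fun z => WithLp.toLp 2 fun p => z.1 p.1 p.2
      map_add' := fun _ _ => rfl
      map_smul' := fun _ _ => rfl }
  have hinner : ∀ z z', inner ℝ (f z) (f z') = (z.1ᵀ * z'.1).trace := by
    intro z z'
    rw [trace_transpose_mul_eq_entrySum, ← Fintype.sum_prod_type', PiLp.inner_apply]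
    exact Finset.sum_congr rfl fun p _ => mul_comm _ _
  have hinj : ∀ z ∈ pairSpan G H, f z = 0 → z = 0 := by
    intro z hz h0
    have h1 : (z.1ᵀ * z.1).trace = 0 := by rw [← hinner, h0, inner_zero_left]
    have h2 := h1
    rw [pairSpan_trace_transpose_mul hsum hz hz] at h2
    rw [← conjTranspose_eq_transpose_of_trivial, trace_conjTranspose_mul_self_eq_zero_iff] at h1 h2
    exact Prod.ext h1 h2
  let T := (pairSpan G H).map f
  let e := stdOrthonormalBasis ℝ T
  have hb : ∀ i, ∃ z ∈ pairSpan G H, f z = (e i : E) := fun i => (e i).2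
  choose b hb hbf using hb
  refine ⟨_, inferInstance, b, hb, fun z hz => ?_⟩
  rw [← sub_eq_zero]
  refine hinj _ (Submodule.sub_mem _ hz
    (Submodule.sum_mem _ fun i _ => Submodule.smul_mem _ _ (hb i))) ?_
  have h1 := congrArg (Subtype.val) (e.sum_repr' ⟨f z, Submodule.mem_map_of_mem hz⟩)
  simp only [Submodule.coe_sum, Submodule.coe_smul, Submodule.coe_inner, ← hbf] at h1
  simp only [map_sub, map_sum, map_smul, ← hinner]
  rw [h1, sub_self]

/-- `∑ i, (b i).1 ⊗ (b i).2` is the kernel of the isometry, so an operation on the first factor can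
be traded for the adjoint operation on the second. Both sides are expanded in `b`; isometry and
adjointness equate the coefficients. -/
theorem pairSpan_swap {ι : Type*} [Fintype ι] {b : ι → Matrix V V ℝ × Matrix W W ℝ}
    (hsum : ∀ X Y, MatrixPair G H X Y → entrySum X = entrySum Y)
    (hb : ∀ i, b i ∈ pairSpan G H)
    (hexp : ∀ z ∈ pairSpan G H, z = ∑ i, ((b i).1ᵀ * z.1).trace • b i)
    (L : Matrix V V ℝ → Matrix V V ℝ) (L' R' : Matrix W W ℝ → Matrix W W ℝ)
    (R : Matrix V V ℝ → Matrix V V ℝ)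
    (hL : ∀ z ∈ pairSpan G H, (L z.1, L' z.2) ∈ pairSpan G H)
    (hR : ∀ z ∈ pairSpan G H, (R z.1, R' z.2) ∈ pairSpan G H)
    (hLR : ∀ Y Y', ((L' Y)ᵀ * Y').trace = (Yᵀ * R' Y').trace) (g g' : V) (h h' : W) :
    ∑ i, L (b i).1 g g' * (b i).2 h h' = ∑ i, (b i).1 g g' * R' (b i).2 h h' := by
  have e1 : ∀ i, L (b i).1 g g' = ∑ j, ((b j).1ᵀ * L (b i).1).trace * (b j).1 g g' := by
    intro i
    have := congrArg (fun z => z.1 g g') (hexp _ (hL _ (hb i)))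
    simpa [Prod.fst_sum, Matrix.sum_apply] using this
  have e2 : ∀ j, R' (b j).2 h h' = ∑ i, ((b i).1ᵀ * R (b j).1).trace * (b i).2 h h' := by
    intro i
    have := congrArg (fun z => z.2 h h') (hexp _ (hR _ (hb i)))
    simpa [Prod.snd_sum, Matrix.sum_apply] using this
  have e3 : ∀ i j, ((b j).1ᵀ * L (b i).1).trace = ((b i).1ᵀ * R (b j).1).trace := by
    intro i j
    rw [pairSpan_trace_transpose_mul hsum (hb j) (hL _ (hb i)),
      pairSpan_trace_transpose_mul hsum (hb i) (hR _ (hb j)), ← hLR, ← Matrix.trace_transpose,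
      transpose_mul, transpose_transpose]
  simp only [e1, e2, Finset.sum_mul, Finset.mul_sum]
  rw [Finset.sum_comm]
  exact Finset.sum_congr rfl fun j _ => Finset.sum_congr rfl fun i _ => by rw [e3]; ring

/-- Transposing the equation shows that `C` commutes with `D`, hence with `D⁻¹`. Then `C = Cᵀ * D⁻¹
* C` is a congruence of a positive definite matrix. -/
theorem posSemidef_of_mul_self_eq {n : Type*} [Fintype n] [DecidableEq n] {C D : Matrix n n ℝ}
    (hC : Cᵀ = C) (hD : D.PosDef) (h : C * C = C * D) : C.PosSemidef := by
  have hDt : Dᵀ = D := by simpa using hD.isHermitian.eq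
  have h' : C * C = D * C := by
    have := congrArg Matrix.transpose h
    simpa [transpose_mul, hC, hDt] using this
  have hdet : IsUnit D.det := (Matrix.isUnit_iff_isUnit_det _).1 hD.isUnit
  have e : Cᴴ * D⁻¹ * C = C := by
    rw [conjTranspose_eq_transpose_of_trivial, hC]
    have h1 : C * D⁻¹ = D⁻¹ * C := by
      calc C * D⁻¹ = D⁻¹ * (D * C) * D⁻¹ := by
            rw [← Matrix.mul_assoc, Matrix.nonsing_inv_mul _ hdet, Matrix.one_mul]
        _ = D⁻¹ * (C * D) * D⁻¹ := by rw [← h', h]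
        _ = D⁻¹ * C := by
            rw [Matrix.mul_assoc, Matrix.mul_assoc, Matrix.mul_nonsing_inv _ hdet,
              Matrix.mul_one]
    rw [h1, Matrix.mul_assoc, h', ← Matrix.mul_assoc, Matrix.nonsing_inv_mul _ hdet,
      Matrix.one_mul]
  rw [← e]
  exact hD.inv.posSemidef.conjTranspose_mul_mul_same C

end Converse

/-! ### From equal entry sums to a Lasserre solution. -/

section Feasible

variable {V W : Type*} [Fintype V] [DecidableEq V] [Fintype W] [DecidableEq W]
  {G : SimpleGraph V} {H : SimpleGraph W} [DecidableRel G.Adj] [DecidableRel H.Adj]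

open scoped Kronecker in
-- With `C` this sum and `Z = ∑ j, (b j).2ᵀ * (b j).2`, swapping multiplication by `(b j).1` for
-- multiplication by `(b j).2ᵀ` gives `C * C = C * (1 ⊗ₖ Z)`, and `posSemidef_of_mul_self_eq`
-- applies.
theorem posSemidef_sum_kronecker {ι : Type*} [Fintype ι] {b : ι → Matrix V V ℝ × Matrix W W ℝ}
    (hsum : ∀ X Y, MatrixPair G H X Y → entrySum X = entrySum Y)
    (hb : ∀ i, b i ∈ pairSpan G H)
    (hexp : ∀ z ∈ pairSpan G H, z = ∑ i, ((b i).1ᵀ * z.1).trace • b i) :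
    (∑ i, (b i).1 ⊗ₖ (b i).2).PosSemidef := by
  have hZ : (∑ j, (b j).2ᵀ * (b j).2).PosDef := by
    refine .of_dotProduct_mulVec_pos ?_ fun x hx => ?_
    · have : (∑ j, (b j).2ᵀ * (b j).2).PosSemidef := posSemidef_sum _ fun j _ =>
        posSemidef_conjTranspose_mul_self _
      exact this.isHermitian
    · have e : star x ⬝ᵥ (∑ j, (b j).2ᵀ * (b j).2) *ᵥ x
          = ∑ j, ((b j).2 *ᵥ x) ⬝ᵥ ((b j).2 *ᵥ x) := by
        rw [Matrix.sum_mulVec, dotProduct_sum]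
        refine Finset.sum_congr rfl fun j _ => ?_
        rw [← Matrix.mulVec_mulVec, Matrix.dotProduct_mulVec, Matrix.vecMul_transpose]
        simp
      have nn : ∀ j ∈ Finset.univ, 0 ≤ ((b j).2 *ᵥ x) ⬝ᵥ ((b j).2 *ᵥ x) := fun j _ =>
        Finset.sum_nonneg fun i _ => mul_self_nonneg _
      rw [e]
      refine lt_of_le_of_ne (Finset.sum_nonneg nn) fun h0 => hx ?_
      have h1 := (Finset.sum_eq_zero_iff_of_nonneg nn).1 h0.symm
      -- Definiteness comes from the identity lying in the span: a vector killed by every `(b j).2`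
      -- is killed by `1`.
      have h2 : (1 : Matrix W W ℝ) = ∑ i, ((b i).1ᵀ * (1 : Matrix V V ℝ)).trace • (b i).2 := by
        simpa [Prod.snd_sum] using congrArg Prod.snd (hexp _ pairSpan_one)
      rw [← Matrix.one_mulVec x, h2, Matrix.sum_mulVec]
      refine Finset.sum_eq_zero fun j hj => ?_
      rw [Matrix.smul_mulVec, dotProduct_self_eq_zero.1 (h1 j hj), smul_zero]
  refine posSemidef_of_mul_self_eq (D := (1 : Matrix V V ℝ) ⊗ₖ ∑ j, (b j).2ᵀ * (b j).2) ?_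
    (PosDef.one.kronecker hZ) ?_
  · ext ⟨g, h⟩ ⟨g', h'⟩
    simp only [Matrix.transpose_apply, Matrix.sum_apply, Matrix.kroneckerMap_apply]
    exact pairSpan_swap hsum hb hexp Matrix.transpose Matrix.transpose Matrix.transpose
      Matrix.transpose (fun _ => pairSpan_transpose) (fun _ => pairSpan_transpose)
      (fun Y Y' => by rw [← Matrix.trace_transpose, transpose_mul, transpose_transpose,
        Matrix.trace_mul_comm]) g g' h' h
  · have hswap : ∀ j, ∑ i, ((b i).1 * (b j).1) ⊗ₖ (b i).2 =
        ∑ i, (b i).1 ⊗ₖ ((b i).2 * (b j).2ᵀ) := by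
      intro j
      ext ⟨g, h⟩ ⟨g', h'⟩
      simp only [Matrix.sum_apply, Matrix.kroneckerMap_apply]
      exact pairSpan_swap hsum hb hexp (· * (b j).1) (· * (b j).2) (· * (b j).2ᵀ) (· * (b j).1ᵀ)
        (fun _ hz => pairSpan_mul hz (hb j))
        (fun _ hz => pairSpan_mul hz (pairSpan_transpose (hb j)))
        (fun Y Y' => by
          rw [transpose_mul, Matrix.mul_assoc, Matrix.trace_mul_comm, Matrix.mul_assoc]) g g' h h'
    have hone : (1 : Matrix V V ℝ) ⊗ₖ ∑ j, (b j).2ᵀ * (b j).2 =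
        ∑ j, (1 : Matrix V V ℝ) ⊗ₖ ((b j).2ᵀ * (b j).2) := by
      ext ⟨g, h⟩ ⟨g', h'⟩
      simp only [Matrix.sum_apply, Matrix.kroneckerMap_apply, Finset.mul_sum]
    rw [hone, Matrix.mul_sum, Matrix.mul_sum]
    refine Finset.sum_congr rfl fun j _ => ?_
    calc (∑ i, (b i).1 ⊗ₖ (b i).2) * (b j).1 ⊗ₖ (b j).2
        = (∑ i, ((b i).1 * (b j).1) ⊗ₖ (b i).2) * (1 : Matrix V V ℝ) ⊗ₖ (b j).2 := by
          simp only [Matrix.sum_mul, ← Matrix.mul_kronecker_mul, Matrix.mul_one]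
      _ = _ := by
          rw [hswap]
          simp only [Matrix.sum_mul, ← Matrix.mul_kronecker_mul, Matrix.mul_one, Matrix.mul_assoc]

/-- Swapping entrywise multiplication by `M` in `G` and `N` in `H` says `M g g' * C = N h h' * C`
entrywise, whence the zeros. The diagonal sums are the diagonal entries of `1`, expanded in the
basis. -/
theorem exists_posSemidef_kernel
    (hsum : ∀ X Y, MatrixPair G H X Y → entrySum X = entrySum Y)
    (hcard : Fintype.card V = Fintype.card W) :
    ∃ C : Matrix (V × W) (V × W) ℝ, C.PosSemidef ∧
      (∀ g g' h h', ¬ (g = g' ↔ h = h') → C (g, h) (g', h') = 0) ∧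
      (∀ g g' h h', ¬ (G.Adj g g' ↔ H.Adj h h') → C (g, h) (g', h') = 0) ∧
      (∀ g, ∑ h, C (g, h) (g, h) = 1) ∧ (∀ h, ∑ g, C (g, h) (g, h) = 1) ∧
      ∀ p, ∑ q, C p q = Fintype.card V * C p p := by
  obtain ⟨ι, _, b, hb, hexp⟩ := exists_pairSpan_expansion hsum
  have hC := posSemidef_sum_kronecker hsum hb hexp
  set C := ∑ i, Matrix.kroneckerMap (· * ·) (b i).1 (b i).2 with hCdef
  have hCapp : ∀ g g' h h', C (g, h) (g', h') = ∑ i, (b i).1 g g' * (b i).2 h h' := fun g g' h h' =>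
    by simp only [hCdef, Matrix.sum_apply, Matrix.kroneckerMap_apply]
  have htr : ∀ {n : Type _} [Fintype n] [DecidableEq n] (M X Y : Matrix n n ℝ),
      ((M ⊙ X)ᵀ * Y).trace = (Xᵀ * (M ⊙ Y)).trace := by
    intro n _ _ M X Y
    simp only [trace_transpose_mul_eq_entrySum, Matrix.hadamard_apply]
    exact Finset.sum_congr rfl fun _ _ => Finset.sum_congr rfl fun _ _ => by ring
  have hone : ∀ g g' h h', ¬ (g = g' ↔ h = h') → C (g, h) (g', h') = 0 := by
    intro g g' h h' hne
    have := pairSpan_swap hsum hb hexp (1 ⊙ ·) (1 ⊙ ·) (1 ⊙ ·) (1 ⊙ ·)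
      (fun _ hz => pairSpan_hadamard_one hz) (fun _ hz => pairSpan_hadamard_one hz)
      (fun Y Y' => htr 1 Y Y') g g' h h'
    simp only [Matrix.hadamard_apply, Matrix.one_apply, mul_assoc, mul_left_comm _ (ite _ _ _),
      ← Finset.mul_sum, ← hCapp] at this
    by_cases h1 : g = g' <;> by_cases h2 : h = h' <;> simp_all
  have hadj : ∀ g g' h h', ¬ (G.Adj g g' ↔ H.Adj h h') → C (g, h) (g', h') = 0 := by
    intro g g' h h' hne
    have := pairSpan_swap hsum hb hexp (G.adjMatrix ℝ ⊙ ·) (H.adjMatrix ℝ ⊙ ·)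
      (H.adjMatrix ℝ ⊙ ·) (G.adjMatrix ℝ ⊙ ·)
      (fun _ hz => pairSpan_hadamard_adjMatrix hz) (fun _ hz => pairSpan_hadamard_adjMatrix hz)
      (fun Y Y' => htr _ Y Y') g g' h h'
    simp only [Matrix.hadamard_apply, SimpleGraph.adjMatrix_apply, mul_assoc,
      mul_left_comm _ (ite _ _ _), ← Finset.mul_sum, ← hCapp] at this
    by_cases h1 : G.Adj g g' <;> by_cases h2 : H.Adj h h' <;> simp_all
  have hoff : ∀ g h, ∑ h', C (g, h) (g, h') = C (g, h) (g, h) := fun g h =>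
    Finset.sum_eq_single h (fun h' _ hne => hone _ _ _ _ fun hp => hne (hp.1 rfl).symm) (by simp)
  have hone1 := hexp _ pairSpan_one
  refine ⟨C, hC, hone, hadj, fun g => ?_, fun h => ?_, ?_⟩
  · have e := congrArg (fun z => z.1 g g) hone1
    simp only [Matrix.one_apply_eq, Matrix.mul_one, Matrix.trace_transpose, Prod.fst_sum,
      Prod.smul_fst, Matrix.sum_apply, Matrix.smul_apply, smul_eq_mul] at e
    rw [e]
    simp only [hCapp]
    rw [Finset.sum_comm]
    refine Finset.sum_congr rfl fun i _ => ?_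
    rw [← Finset.mul_sum, pairSpan_trace hsum (hb i), mul_comm]; rfl
  · have e := congrArg (fun z => z.2 h h) hone1
    simp only [Matrix.one_apply_eq, Matrix.mul_one, Matrix.trace_transpose, Prod.snd_sum,
      Prod.smul_snd, Matrix.sum_apply, Matrix.smul_apply, smul_eq_mul] at e
    rw [e]
    simp only [hCapp]
    rw [Finset.sum_comm]
    refine Finset.sum_congr rfl fun i _ => ?_
    rw [← Finset.sum_mul]; rfl
  · rintro ⟨g, h⟩
    have hJt : (onesMatrix W)ᵀ = onesMatrix W := rfl
    have hones := (MatrixPair.ones (G := G) (H := H)).mem_pairSpan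
    -- Swapping multiplication by the all-ones matrix shows that `∑ g', C (g, h) (g', h')` equals `∑
    -- h'', C (g, h) (g, h'')` for every `h'`; the latter has only its diagonal term left. Summing
    -- over `h'` produces the factor `card V = card W`.
    have := fun h' => pairSpan_swap hsum hb hexp (· * onesMatrix V) (· * onesMatrix W)
      (· * onesMatrix W) (· * onesMatrix V)
      (fun _ hz => pairSpan_mul hz hones) (fun _ hz => pairSpan_mul hz hones)
      (fun Y Y' => by
        rw [transpose_mul, Matrix.mul_assoc, Matrix.trace_mul_comm, Matrix.mul_assoc, hJt])
      g g h h'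
    calc ∑ q : V × W, C (g, h) q = ∑ h', ∑ i, ((b i).1 * onesMatrix V) g g * (b i).2 h h' := by
          rw [Fintype.sum_prod_type, Finset.sum_comm]
          refine Finset.sum_congr rfl fun h' _ => ?_
          simp only [hCapp, Matrix.mul_apply, onesMatrix_apply, mul_one, Finset.sum_mul]
          exact Finset.sum_comm
      _ = ∑ h' : W, ∑ h'', C (g, h) (g, h'') := by
          refine Finset.sum_congr rfl fun h' _ => ?_
          rw [this]
          simp only [hCapp, Matrix.mul_apply, onesMatrix_apply, mul_one, Finset.mul_sum]
          exact Finset.sum_comm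
      _ = _ := by simp [hoff, hcard]

theorem card_eq_of_entrySum_eq
    (hsum : ∀ X Y, MatrixPair G H X Y → entrySum X = entrySum Y) :
    Fintype.card V = Fintype.card W := by
  have h := hsum _ _ .ones
  simp only [entrySum, onesMatrix_apply, Finset.sum_const, Finset.card_univ, nsmul_eq_mul,
    mul_one] at h
  exact Nat.mul_self_inj.1 (by exact_mod_cast h)

/-- The value of a function of two variables, extended by `1`, on a set with at most two
elements. -/
noncomputable def pairValue {P : Type*} [DecidableEq P] (C : P → P → ℝ) (I : Finset P) : ℝ :=
  open Classical in if h : ∃ z : P × P, I = {z.1, z.2} then C h.choose.1 h.choose.2 else 1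

theorem pairValue_pair {P : Type*} [DecidableEq P] {C : P → P → ℝ} (hC : ∀ p q, C p q = C q p)
    (p q : P) : pairValue C {p, q} = C p q := by
  have h : ∃ z : P × P, ({p, q} : Finset P) = {z.1, z.2} := ⟨(p, q), rfl⟩
  rw [pairValue, dif_pos h]
  have hs := h.choose_spec
  generalize h.choose = z at hs
  have hs' := congrArg (fun s : Finset P => (s : Set P)) hs
  simp only [Finset.coe_insert, Finset.coe_singleton] at hs'
  rcases Set.pair_eq_pair_iff.1 hs' with ⟨h1, h2⟩ | ⟨h1, h2⟩
  · rw [h1, h2]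
  · rw [h1, h2, hC]

theorem pairValue_empty {P : Type*} [DecidableEq P] (C : P → P → ℝ) : pairValue C ∅ = 1 := by
  rw [pairValue, dif_neg]
  rintro ⟨z, hz⟩
  exact Finset.notMem_empty z.1 (hz ▸ Finset.mem_insert_self _ _)

theorem lasserreFeasible_of_entrySum_eq
    (hsum : ∀ X Y, MatrixPair G H X Y → entrySum X = entrySum Y) : LasserreFeasible 1 G H := by
  have hcard := card_eq_of_entrySum_eq hsum
  obtain ⟨C, hC, hone, hadj, hright, hleft, hsumC⟩ := exists_posSemidef_kernel hsum hcard
  have hsymm : ∀ p q, C p q = C q p := fun p q => by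
    have := congrFun (congrFun hC.isHermitian.eq q) p
    simpa using this
  have hpair := pairValue_pair hsymm
  have hsing : ∀ p, pairValue C {p} = C p p := fun p => by simpa using hpair p p
  have hval : pairValue C (∅ : Finset (V × W)) = 1 := pairValue_empty C
  have hempty : ∀ I : Finset (V × W), I.card + 2 ≤ 2 * 1 → I = ∅ := fun I hI =>
    Finset.card_eq_zero.1 (by omega)
  refine ⟨pairValue C, ⟨?_, ?_, ?_, ?_, hval⟩⟩
  -- Without vertices there is nothing to average over; the only index is `∅`, and the moment matrix
  -- is the matrix with single entry `1`.
  · rcases isEmpty_or_nonempty V with hV | hV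
    · have h0 : ∀ I : {I : Finset (V × W) // I.card ≤ 1}, I.1 = ∅ := fun I =>
        Finset.eq_empty_of_isEmpty I.1
      have : momentMatrix 1 (pairValue C) = (Matrix.of fun _ (_ : Unit) => (1 : ℝ)) *
          (Matrix.of fun _ (_ : Unit) => (1 : ℝ))ᴴ := by
        ext I J
        simp [momentMatrix, h0, hval, Matrix.mul_apply]
      rw [this]
      exact posSemidef_self_mul_conjTranspose _
    · have hn : (Fintype.card V : ℝ) ≠ 0 := by exact_mod_cast Fintype.card_ne_zero
      -- The row of `∅` is the sum of all rows of `C` divided by `card V`: by the row sum identity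
      -- this gives `C p p` at `{p}` and `1` at `∅`. So the moment matrix is a congruence of `C`.
      let B : Matrix (V × W) {I : Finset (V × W) // I.card ≤ 1} ℝ := Matrix.of fun p I =>
        if I.1 = ∅ then (Fintype.card V : ℝ)⁻¹ else if I.1 = {p} then 1 else 0
      have hB0 : ∀ p I, I.1 = ∅ → B p I = (Fintype.card V : ℝ)⁻¹ := fun p I hI => by
        simp [B, hI]
      have hB1 : ∀ p q I, I.1 = {q} → B p I = if p = q then 1 else 0 := fun p q I hI => by
        simp [B, hI, eq_comm]
      have hM : momentMatrix 1 (pairValue C) = Bᴴ * C * B := by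
        have htot : ∑ p, C p p = Fintype.card V := by
          rw [Fintype.sum_prod_type]; simp [hright]
        have hcases : ∀ I : {I : Finset (V × W) // I.card ≤ 1}, I.1 = ∅ ∨ ∃ p, I.1 = {p} := by
          intro I
          rcases Nat.le_one_iff_eq_zero_or_eq_one.1 I.2 with h | h
          · exact .inl (Finset.card_eq_zero.1 h)
          · exact .inr (Finset.card_eq_one.1 h)
        ext I J
        simp only [Matrix.mul_apply, Matrix.conjTranspose_apply, star_trivial, momentMatrix,
          Matrix.of_apply]
        rcases hcases I with hI | ⟨p, hI⟩ <;> rcases hcases J with hJ | ⟨q, hJ⟩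
        · simp only [hB0 _ _ hI, hB0 _ _ hJ, hI, hJ, ← Finset.mul_sum, ← Finset.sum_mul,
            Finset.empty_union, hval]
          rw [Finset.sum_comm]
          simp only [hsumC, ← Finset.mul_sum, htot]
          field_simp
        · simp only [hB0 _ _ hI, hB1 _ _ _ hJ, hI, hJ, ← Finset.mul_sum,
            Finset.empty_union, hsing, mul_ite, mul_one, mul_zero, Finset.sum_ite_eq',
            Finset.mem_univ, if_true]
          rw [Finset.sum_congr rfl fun p _ => hsymm p q, hsumC]
          field_simp
        · simp only [hB1 _ _ _ hI, hB0 _ _ hJ, hI, hJ, ← Finset.sum_mul, ite_mul, one_mul,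
            zero_mul, Finset.sum_ite_eq', Finset.mem_univ, if_true, Finset.union_empty, hsing]
          rw [hsumC]
          field_simp
        · simp only [hB1 _ _ _ hI, hB1 _ _ _ hJ, hI, hJ, ite_mul, one_mul, zero_mul, mul_ite,
            mul_one, mul_zero, Finset.sum_ite_eq', Finset.mem_univ, if_true]
          exact hpair p q
      rw [hM]
      exact hC.conjTranspose_mul_mul_same B
  · intro I hI g
    obtain rfl := hempty I hI
    simp only [Finset.empty_union, hsing, hright, hval]
  · intro I hI h
    obtain rfl := hempty I hI
    simp only [Finset.empty_union, hsing, hleft, hval]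
  · intro I hI hnot
    unfold IsPartialIso at hnot
    push Not at hnot
    obtain ⟨p, hp, q, hq, hpq⟩ := hnot
    have hne : p ≠ q := by rintro rfl; simp at hpq
    have hIeq : {p, q} = I := by
      refine Finset.eq_of_subset_of_card_le ?_ ?_
      · intro x hx
        simp only [Finset.mem_insert, Finset.mem_singleton] at hx
        rcases hx with rfl | rfl <;> assumption
      · rw [Finset.card_pair hne]; exact hI
    rw [← hIeq, hpair]
    by_cases h1 : p.1 = q.1 ↔ p.2 = q.2
    · exact hadj p.1 q.1 p.2 q.2 fun h2 => by have := hpq h1; tauto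
    · exact hone p.1 q.1 p.2 q.2 h1

end Feasible

/-! ### Connected vertex sets. -/

section Connected

variable {U : Type*} {F : SimpleGraph U}

/-- A non-empty set `S` of vertices that induces a connected subgraph of `F`. -/
def ConnOn (F : SimpleGraph U) (S : Set U) : Prop :=
  S.Nonempty ∧ ∀ T : Set U, (∃ x ∈ S, x ∈ T) →
    (∀ x ∈ S, x ∈ T → ∀ y ∈ S, F.Adj x y → y ∈ T) → S ⊆ T

/-- The closure form of connectedness lets the minor arguments work with sets alone, free of walks
and subtypes. -/
theorem connOn_iff_induce_connected {S : Set U} : ConnOn F S ↔ (F.induce S).Connected := by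
  constructor
  · rintro ⟨⟨s, hs⟩, h⟩
    rw [SimpleGraph.connected_iff]
    refine ⟨?_, ⟨⟨s, hs⟩⟩⟩
    rintro ⟨x, hx⟩ ⟨y, hy⟩
    obtain ⟨_, h'⟩ := h {y | ∃ hy : y ∈ S, (F.induce S).Reachable ⟨x, hx⟩ ⟨y, hy⟩}
      ⟨x, hx, hx, .refl _⟩ (by
        rintro z _ ⟨hz, hxz⟩ w hw hzw
        exact ⟨hw, hxz.trans (SimpleGraph.Adj.reachable (by simpa using hzw))⟩) hy
    exact h'
  · intro h
    obtain ⟨⟨s, hs⟩⟩ := h.nonempty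
    refine ⟨⟨s, hs⟩, ?_⟩
    rintro T ⟨x, hx, hxT⟩ hT y hy
    obtain ⟨p⟩ := h.preconnected ⟨x, hx⟩ ⟨y, hy⟩
    have : ∀ (u v : S), (F.induce S).Walk u v → u.1 ∈ T → v.1 ∈ T := by
      intro u v p
      induction p with
      | nil => exact id
      | cons hadj _ ih => exact fun hu => ih (hT _ (Subtype.coe_prop _) hu _ (Subtype.coe_prop _)
          (by simpa using hadj))
    exact this _ _ p hxT

theorem connOn_singleton (x : U) : ConnOn F {x} :=
  ⟨⟨x, rfl⟩, by rintro T ⟨y, rfl, hy⟩ _ z rfl; exact hy⟩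

theorem ConnOn.union {A B : Set U} (hA : ConnOn F A) (hB : ConnOn F B)
    (h : ∃ x ∈ A, ∃ y ∈ B, F.Adj x y) : ConnOn F (A ∪ B) := by
  obtain ⟨x, hx, y, hy, hxy⟩ := h
  refine ⟨⟨x, .inl hx⟩, fun T hT hcl => ?_⟩
  have hAT : ∀ z ∈ A, z ∈ T → A ⊆ T := fun z hz hzT => hA.2 T ⟨z, hz, hzT⟩
    fun p hp hpT q hq => hcl p (.inl hp) hpT q (.inl hq)
  have hBT : ∀ z ∈ B, z ∈ T → B ⊆ T := fun z hz hzT => hB.2 T ⟨z, hz, hzT⟩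
    fun p hp hpT q hq => hcl p (.inr hp) hpT q (.inr hq)
  obtain ⟨z, hz | hz, hzT⟩ := hT
  · have h1 := hAT z hz hzT
    exact Set.union_subset h1 (hBT y hy (hcl x (.inl hx) (h1 hx) y (.inr hy) hxy))
  · have h1 := hBT z hz hzT
    exact Set.union_subset (hAT x hx (hcl y (.inr hy) (h1 hy) x (.inl hx) hxy.symm)) h1

theorem ConnOn.exists_adj {S T : Set U} (hS : ConnOn F S) {x y : U} (hx : x ∈ S) (hxT : x ∈ T)
    (hy : y ∈ S) (hyT : y ∉ T) : ∃ p ∈ S, p ∈ T ∧ ∃ q ∈ S, q ∉ T ∧ F.Adj p q := by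
  by_contra hcon
  push Not at hcon
  refine hyT (hS.2 T ⟨x, hx, hxT⟩ (fun p hp hpT q hq hpq => ?_) hy)
  by_contra hqT
  exact hcon p hp hpT q hq hqT hpq

end Connected

/-! ### Noncrossing graphs on a line are outerplanar. -/

section Noncrossing

variable {U : Type*} {F : SimpleGraph U}

/-- Placing the vertices of `F` on a line according to `pos`, no two edges of `F` cross. -/
def IsNoncrossing (F : SimpleGraph U) (pos : U → ℕ) : Prop :=
  Function.Injective pos ∧ ∀ x y z w, F.Adj x y → F.Adj z w →
    pos x < pos z → pos z < pos y → ¬ pos y < pos w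

/-- A discrete Jordan curve argument: some edge of `A` leaves the interval between `b` and `d`. Its
ends separate `b` from `d`, so an edge of `B` must cross it. -/
theorem IsNoncrossing.not_interlaced {pos : U → ℕ} (hF : IsNoncrossing F pos) {A B : Set U}
    (hA : ConnOn F A) (hB : ConnOn F B) (hAB : Disjoint A B) {a b c d : U} (ha : a ∈ A)
    (hb : b ∈ B) (hc : c ∈ A) (hd : d ∈ B) (hab : pos a < pos b) (hbc : pos b < pos c) :
    ¬ pos c < pos d := by
  intro hcd
  have hne : ∀ x ∈ A, ∀ y ∈ B, pos x ≠ pos y := fun x hx y hy h =>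
    Set.disjoint_left.1 hAB hx (hF.1 h ▸ hy)
  obtain ⟨x, hx, ⟨hx1, hx2⟩, y, hy, hy', hxy⟩ := hA.exists_adj
    (T := {x | pos b < pos x ∧ pos x < pos d}) hc ⟨hbc, hcd⟩ ha (fun h => by
      have := h.1; omega)
  simp only [Set.mem_ofPred_eq, not_and_or, not_lt] at hy'
  have h1 := hne y hy b hb
  have h2 := hne y hy d hd
  by_cases hlt : pos y < pos b
  · obtain ⟨z, hz, ⟨hz1, hz2⟩, w, hw, hw', hzw⟩ := hB.exists_adj
      (T := {z | pos y < pos z ∧ pos z < pos x}) hb ⟨hlt, hx1⟩ hd (fun h => by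
        have := h.2; omega)
    simp only [Set.mem_ofPred_eq, not_and_or, not_lt] at hw'
    have h3 := hne y hy w hw
    have h4 := hne x hx w hw
    by_cases hwy : pos w < pos y
    · exact hF.2 w z y x hzw.symm hxy.symm hwy hz1 hz2
    · exact hF.2 y x z w hxy.symm hzw hz1 hz2 (by omega)
  · have hdy : pos d < pos y := by omega
    obtain ⟨z, hz, ⟨hz1, hz2⟩, w, hw, hw', hzw⟩ := hB.exists_adj
      (T := {z | pos x < pos z ∧ pos z < pos y}) hd ⟨hx2, hdy⟩ hb (fun h => by
        have := h.1; omega)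
    simp only [Set.mem_ofPred_eq, not_and_or, not_lt] at hw'
    have h3 := hne y hy w hw
    have h4 := hne x hx w hw
    by_cases hwy : pos w < pos x
    · exact hF.2 w z x y hzw.symm hxy hwy hz1 hz2
    · exact hF.2 x y z w hxy hzw hz1 hz2 (by omega)

/-- With one representative per branch set, sorted by position, the union of the first and third
sets interlaces with the union of the second and fourth. -/
theorem IsNoncrossing.not_isMinor_K4 {pos : U → ℕ} (hF : IsNoncrossing F pos) :
    ¬ IsMinor (SimpleGraph.completeGraph (Fin 4)) F := by
  rintro ⟨B, hconn, hdisj, hadj⟩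
  have hB : ∀ i, ConnOn F (B i) := fun i => connOn_iff_induce_connected.2 (hconn i)
  choose x hx using fun i => (hB i).1
  have hinj : Function.Injective (pos ∘ x) := by
    intro i j hij
    by_contra hne
    exact Set.disjoint_left.1 (hdisj i j hne) (hx i) (hF.1 hij ▸ hx j)
  have hsm : StrictMono ((pos ∘ x) ∘ Tuple.sort (pos ∘ x)) :=
    (Tuple.monotone_sort (pos ∘ x)).strictMono_of_injective
      (hinj.comp (Equiv.injective _))
  set σ := Tuple.sort (pos ∘ x)
  have hσ : ∀ {i j : Fin 4}, i ≠ j → σ i ≠ σ j := fun h => σ.injective.ne h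
  have hU : ∀ i j : Fin 4, i ≠ j → ConnOn F (B (σ i) ∪ B (σ j)) := fun i j h =>
    (hB _).union (hB _) (hadj _ _ (by simpa using hσ h))
  refine hF.not_interlaced (hU 0 2 (by decide)) (hU 1 3 (by decide)) ?_
    (.inl (hx (σ 0))) (.inl (hx (σ 1))) (.inr (hx (σ 2))) (.inr (hx (σ 3)))
    (hsm (by decide)) (hsm (by decide)) (hsm (by decide))
  simp only [Set.disjoint_union_left, Set.disjoint_union_right]
  exact ⟨⟨hdisj _ _ (hσ (by decide)), hdisj _ _ (hσ (by decide))⟩,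
    hdisj _ _ (hσ (by decide)), hdisj _ _ (hσ (by decide))⟩

/-- However the two representatives on one side lie among the three sorted ones on the other, each
of the two can be joined with a different one of the three so that the unions interlace. `p1` to
`p4` are the possible patterns. -/
theorem IsNoncrossing.not_isMinor_K23 {pos : U → ℕ} (hF : IsNoncrossing F pos) :
    ¬ IsMinor (completeBipartiteGraph (Fin 2) (Fin 3)) F := by
  rintro ⟨B, hconn, hdisj, hadj⟩
  have hB : ∀ i, ConnOn F (B i) := fun i => connOn_iff_induce_connected.2 (hconn i)
  choose x hx using fun i => (hB i).1
  have hinj : Function.Injective (pos ∘ x) := by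
    intro i j hij
    by_contra hne
    exact Set.disjoint_left.1 (hdisj i j hne) (hx i) (hF.1 hij ▸ hx j)
  let c : Fin 3 → ℕ := fun i => pos (x (.inr i))
  have hsm : StrictMono (c ∘ Tuple.sort c) :=
    (Tuple.monotone_sort c).strictMono_of_injective
      ((hinj.comp Sum.inr_injective).comp (Equiv.injective _))
  set σ := Tuple.sort c
  have hU : ∀ (i : Fin 2) (j : Fin 3), ConnOn F (B (.inl i) ∪ B (.inr j)) := fun i j =>
    (hB _).union (hB _) (hadj _ _ (by simp))
  have hD : ∀ (i i' : Fin 2) (j j' : Fin 3), i ≠ i' → j ≠ j' →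
      Disjoint (B (.inl i) ∪ B (.inr (σ j))) (B (.inl i') ∪ B (.inr (σ j'))) := by
    intro i i' j j' hi hj
    simp only [Set.disjoint_union_left, Set.disjoint_union_right]
    exact ⟨⟨hdisj _ _ (by simpa using hi), hdisj _ _ (by simp)⟩, hdisj _ _ (by simp),
      hdisj _ _ (by simpa using σ.injective.ne hj)⟩
  have key : ∀ i i' : Fin 2, i ≠ i' → ¬ pos (x (.inl i)) < pos (x (.inl i')) := by
    intro i i' hi hlt
    have h01 : pos (x (.inr (σ 0))) < pos (x (.inr (σ 1))) := hsm (by decide)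
    have h12 : pos (x (.inr (σ 1))) < pos (x (.inr (σ 2))) := hsm (by decide)
    have hne : ∀ (i : Fin 2) (j : Fin 3), pos (x (.inl i)) ≠ pos (x (.inr (σ j))) :=
      fun i j h => Sum.inl_ne_inr (hinj h)
    have hc := fun j => hx (.inr (σ j))
    have ha := hx (.inl i)
    have hb := hx (.inl i')
    have p1 : ¬ pos (x (.inl i')) < pos (x (.inr (σ 1))) := fun h =>
      hF.not_interlaced (hU i (σ 1)) (hU i' (σ 2)) (hD _ _ _ _ hi (by decide))
        (.inl ha) (.inl hb) (.inr (hc 1)) (.inr (hc 2)) hlt h h12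
    have p2 : ¬ pos (x (.inr (σ 1))) < pos (x (.inl i)) := fun h =>
      hF.not_interlaced (hU i (σ 0)) (hU i' (σ 1)) (hD _ _ _ _ hi (by decide))
        (.inr (hc 0)) (.inr (hc 1)) (.inl ha) (.inl hb) h01 h hlt
    have p3 : ∀ j j', j ≠ j' → pos (x (.inr (σ j))) < pos (x (.inr (σ j'))) →
        pos (x (.inl i)) < pos (x (.inr (σ j))) →
        ¬ pos (x (.inr (σ j'))) < pos (x (.inl i')) := fun j j' hne hjj h h' =>
      hF.not_interlaced (hU i (σ j')) (hU i' (σ j)) (hD _ _ _ _ hi hne.symm)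
        (.inl ha) (.inr (hc j)) (.inr (hc j')) (.inl hb) h hjj h'
    have p4 : pos (x (.inr (σ 0))) < pos (x (.inl i)) →
        ¬ pos (x (.inl i')) < pos (x (.inr (σ 2))) := fun h h' =>
      hF.not_interlaced (hU i' (σ 0)) (hU i (σ 2)) (hD _ _ _ _ hi.symm (by decide))
        (.inr (hc 0)) (.inl ha) (.inl hb) (.inr (hc 2)) h hlt h'
    have q1 := p3 0 1 (by decide) h01
    have q2 := p3 1 2 (by decide) h12
    have n1 := hne i 0
    have n2 := hne i 1
    have n3 := hne i' 1
    have n4 := hne i' 2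
    by_cases h0 : pos (x (.inl i)) < pos (x (.inr (σ 0)))
    · exact q1 h0 (by omega)
    · by_cases h2 : pos (x (.inr (σ 2))) < pos (x (.inl i'))
      · exact q2 (by omega) h2
      · exact p4 (by omega) (by omega)
  have hne : pos (x (.inl 0)) ≠ pos (x (.inl 1)) := fun h => by
    have := hinj h; simp at this
  have := key 0 1 (by decide)
  have := key 1 0 (by decide)
  omega

theorem IsNoncrossing.isOuterplanar {pos : U → ℕ} (hF : IsNoncrossing F pos) :
    IsOuterplanar F := ⟨hF.not_isMinor_K4, hF.not_isMinor_K23⟩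

end Noncrossing

/-! ### Contracting identified vertices. -/

section Quotient

variable {U : Type*} (E Q : U → U → Prop)

/-- The simple graph obtained from the relation `E` by identifying the vertices related by `Q`. -/
def quotGraph : SimpleGraph (Quot Q) :=
  SimpleGraph.fromRel fun p q => ∃ x y, Quot.mk Q x = p ∧ Quot.mk Q y = q ∧ E x y

variable {E Q}

/-- Inside the preimage, a set closed under adjacency is a union of `Q`-classes, because `Q`-related
vertices are adjacent or equal. It therefore descends to the quotient. -/
theorem ConnOn.preimage_quot {S : Set (Quot Q)} (hS : ConnOn (quotGraph E Q) S) :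
    ConnOn (SimpleGraph.fromRel fun x y => E x y ∨ Q x y) (Quot.mk Q ⁻¹' S) := by
  obtain ⟨⟨s, hs⟩, h⟩ := hS
  obtain ⟨s, rfl⟩ := Quot.exists_rep s
  refine ⟨⟨s, hs⟩, ?_⟩
  rintro T ⟨x, hx, hxT⟩ hT
  have hQ : ∀ y z, y ∈ Quot.mk Q ⁻¹' S → Q y z → (y ∈ T ↔ z ∈ T) := by
    intro y z hy hyz
    by_cases hne : y = z
    · rw [hne]
    have hz : z ∈ Quot.mk Q ⁻¹' S := by
      rw [Set.mem_preimage, ← Quot.sound hyz]; exact hy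
    refine ⟨fun hyT => hT y hy hyT z hz ?_, fun hzT => hT z hz hzT y hy ?_⟩
    · exact ⟨hne, .inl (.inr hyz)⟩
    · exact ⟨fun e => hne e.symm, .inr (.inr hyz)⟩
  have hsat : ∀ y z, Relation.EqvGen Q y z → y ∈ Quot.mk Q ⁻¹' S → (y ∈ T ↔ z ∈ T) := by
    intro y z hyz
    induction hyz with
    | rel y z hyz => exact fun hy => hQ y z hy hyz
    | refl y => exact fun _ => Iff.rfl
    | symm y z hyz ih =>
      intro hz
      refine (ih ?_).symm
      rw [Set.mem_preimage, Quot.eqvGen_sound hyz]; exact hz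
    | trans y z w hyz _ ih ih' =>
      intro hy
      refine (ih hy).trans (ih' ?_)
      rw [Set.mem_preimage, ← Quot.eqvGen_sound hyz]; exact hy
  have hsat' : ∀ y z, Quot.mk Q y = Quot.mk Q z → y ∈ Quot.mk Q ⁻¹' S → y ∈ T → z ∈ T :=
    fun y z hyz hy hyT => (hsat y z (Quot.eqvGen_exact hyz) hy).1 hyT
  have hmain := h {p | ∃ y, Quot.mk Q y = p ∧ y ∈ T} ⟨_, hx, x, rfl, hxT⟩ (by
    rintro p hp ⟨y, rfl, hyT⟩ q hq ⟨hne, ⟨y', z', hy', rfl, hE⟩ | ⟨z', y', rfl, hy', hE⟩⟩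
    · refine ⟨z', rfl, hT y' (by rw [Set.mem_preimage, hy']; exact hp)
        (hsat' _ _ hy'.symm hp hyT) z' hq ⟨?_, .inl (.inl hE)⟩⟩
      rintro rfl; exact hne hy'.symm
    · refine ⟨z', rfl, hT y' (by rw [Set.mem_preimage, hy']; exact hp)
        (hsat' _ _ hy'.symm hp hyT) z' hq ⟨?_, .inr (.inl hE)⟩⟩
      rintro rfl; exact hne hy'.symm)
  intro z hz
  obtain ⟨y, hyz, hyT⟩ := hmain hz
  exact hsat' y z hyz (by rw [Set.mem_preimage, hyz]; exact hz) hyT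

theorem IsMinor.of_quotGraph {N : Type*} {K : SimpleGraph N} (h : IsMinor K (quotGraph E Q)) :
    IsMinor K (SimpleGraph.fromRel fun x y => E x y ∨ Q x y) := by
  obtain ⟨B, hconn, hdisj, hadj⟩ := h
  refine ⟨fun u => Quot.mk Q ⁻¹' B u, fun u => ?_, fun u u' hne => ?_, fun u u' huu => ?_⟩
  · exact connOn_iff_induce_connected.1 (connOn_iff_induce_connected.2 (hconn u)).preimage_quot
  · exact (hdisj u u' hne).preimage _
  · obtain ⟨p, hp, q, hq, hne, ⟨x, y, rfl, rfl, hE⟩ | ⟨y, x, rfl, rfl, hE⟩⟩ := hadj u u' huu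
    · exact ⟨x, hp, y, hq, fun e => hne (e ▸ rfl), .inl (.inl hE)⟩
    · exact ⟨x, hp, y, hq, fun e => hne (e ▸ rfl), .inr (.inl hE)⟩

theorem IsOuterplanar.quotGraph
    (h : IsOuterplanar (SimpleGraph.fromRel fun x y => E x y ∨ Q x y)) :
    IsOuterplanar (quotGraph E Q) :=
  ⟨fun h' => h.1 h'.of_quotGraph, fun h' => h.2 h'.of_quotGraph⟩

/-- The maps to the vertices of `G` that respect the edges in `E` and the equalities in `Q`. -/
def RelHom {V : Type*} (E Q : U → U → Prop) (G : SimpleGraph V) (f : U → V) : Prop :=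
  (∀ x y, E x y → G.Adj (f x) (f y)) ∧ ∀ x y, Q x y → f x = f y

theorem card_relHom_eq_card_hom {V : Type*} (G : SimpleGraph V)
    (hE : ∀ x y, E x y → Quot.mk Q x ≠ Quot.mk Q y) :
    Nat.card {f : U → V // RelHom E Q G f} = Nat.card (quotGraph E Q →g G) := by
  refine Nat.card_congr
    { toFun := fun f => ⟨Quot.lift f.1 f.2.2, ?_⟩
      invFun := fun φ => ⟨fun x => φ (Quot.mk Q x), fun x y h => φ.map_rel ?_, fun x y h => ?_⟩
      left_inv := fun f => rfl
      right_inv := fun φ => ?_ }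
  · rintro p q ⟨hne, ⟨x, y, rfl, rfl, h⟩ | ⟨x, y, rfl, rfl, h⟩⟩
    · exact f.2.1 _ _ h
    · exact (f.2.1 _ _ h).symm
  · exact ⟨hE x y h, .inl ⟨x, y, rfl, rfl, h⟩⟩
  · exact congrArg φ (Quot.sound h)
  · ext p
    obtain ⟨x, rfl⟩ := Quot.exists_rep p
    rfl

/-- An edge whose ends are identified would need a loop in the target. `quotGraph` silently drops
such an edge, so this case has to be kept apart from `card_relHom_eq_card_hom`. -/
theorem card_relHom_eq_zero {V : Type*} (G : SimpleGraph V)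
    (hE : ¬ ∀ x y, E x y → Quot.mk Q x ≠ Quot.mk Q y) :
    Nat.card {f : U → V // RelHom E Q G f} = 0 := by
  push Not at hE
  obtain ⟨x, y, hxy, he⟩ := hE
  have : IsEmpty {f : U → V // RelHom E Q G f} := by
    refine ⟨fun f => ?_⟩
    have h1 := f.2.1 x y hxy
    have h2 : f.1 x = f.1 y := congrArg (Quot.lift f.1 f.2.2) he
    rw [h2] at h1
    exact G.loopless.irrefl _ h1
  exact Nat.card_of_isEmpty

end Quotient

/-! ### Matrix expressions count homomorphisms from noncrossing graphs. -/

section Representation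

variable {V W : Type*} [Fintype V] [DecidableEq V] [Fintype W] [DecidableEq W]

/-- The matrix counting the maps that respect `E` and `Q`, by their values at `a` and `b`. -/
noncomputable def relHomMatrix {U V : Type*} (E Q : U → U → Prop) (G : SimpleGraph V) (a b : U) :
    Matrix V V ℝ :=
  Matrix.of fun u v => (Nat.card {f : U → V // RelHom E Q G f ∧ f a = u ∧ f b = v} : ℝ)

/-- The relation making up a series composition of two graphs: the two relations on the two parts,
and a pair joining `b` to `a`. -/
inductive SeriesRel {U U' : Type*} (R : U → U → Prop) (R' : U' → U' → Prop) (j : U → U' → Prop) :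
    U ⊕ U' → U ⊕ U' → Prop
  | left {x y : U} : R x y → SeriesRel R R' j (.inl x) (.inl y)
  | right {x y : U'} : R' x y → SeriesRel R R' j (.inr x) (.inr y)
  | join {x : U} {y : U'} : j x y → SeriesRel R R' j (.inl x) (.inr y)

theorem relHom_series {U U' V : Type*} {E Q : U → U → Prop} {E' Q' : U' → U' → Prop}
    {G : SimpleGraph V} {b : U} {a : U'} {f : U ⊕ U' → V} :
    RelHom (SeriesRel E E' fun _ _ => False) (SeriesRel Q Q' fun x y => x = b ∧ y = a) G f ↔
      RelHom E Q G (f ∘ Sum.inl) ∧ RelHom E' Q' G (f ∘ Sum.inr) ∧ f (.inl b) = f (.inr a) := by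
  constructor
  · rintro ⟨hE, hQ⟩
    exact ⟨⟨fun x y h => hE _ _ (.left h), fun x y h => hQ _ _ (.left h)⟩,
      ⟨fun x y h => hE _ _ (.right h), fun x y h => hQ _ _ (.right h)⟩,
      hQ _ _ (.join ⟨rfl, rfl⟩)⟩
  · rintro ⟨⟨hE, hQ⟩, ⟨hE', hQ'⟩, hj⟩
    refine ⟨?_, ?_⟩
    · rintro _ _ (h | h | h)
      · exact hE _ _ h
      · exact hE' _ _ h
      · exact h.elim
    · rintro _ _ (h | h | ⟨rfl, rfl⟩)
      · exact hQ _ _ h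
      · exact hQ' _ _ h
      · exact hj

/-- The summation index of the matrix product is the common value at the two identified vertices. -/
theorem relHomMatrix_series {U U' V : Type*} [Fintype V] [Finite U] [Finite U'] (E Q : U → U → Prop)
    (E' Q' : U' → U' → Prop) (G : SimpleGraph V) (a b : U) (a' b' : U') :
    relHomMatrix (SeriesRel E E' fun _ _ => False) (SeriesRel Q Q' fun x y => x = b ∧ y = a') G
      (.inl a) (.inr b') = relHomMatrix E Q G a b * relHomMatrix E' Q' G a' b' := by
  ext u v
  simp only [relHomMatrix, Matrix.mul_apply, Matrix.of_apply]
  norm_cast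
  simp only [← Nat.card_prod]
  rw [← Nat.card_sigma]
  refine Nat.card_congr
    { toFun := fun f => ⟨f.1 (.inl b), ⟨f.1 ∘ Sum.inl, (relHom_series.1 f.2.1).1, f.2.2.1, rfl⟩,
        ⟨f.1 ∘ Sum.inr, (relHom_series.1 f.2.1).2.1, (relHom_series.1 f.2.1).2.2.symm, f.2.2.2⟩⟩
      invFun := fun z => ⟨Sum.elim z.2.1.1 z.2.2.1, relHom_series.2
        ⟨z.2.1.2.1, z.2.2.2.1, z.2.1.2.2.2.trans z.2.2.2.2.1.symm⟩, z.2.1.2.2.1, z.2.2.2.2.2⟩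
      left_inv := fun f => Subtype.ext (Sum.elim_comp_inl_inr f.1)
      right_inv := ?_ }
  rintro ⟨w, ⟨f, hf, hfa, rfl⟩, ⟨g, hg, hga, hgb⟩⟩
  rfl

theorem relHomMatrix_add_eq {U V : Type*} [DecidableEq V] (E Q : U → U → Prop)
    (G : SimpleGraph V) (a b : U) :
    relHomMatrix E (fun x y => Q x y ∨ x = a ∧ y = b) G a b = 1 ⊙ relHomMatrix E Q G a b := by
  ext u v
  simp only [relHomMatrix, Matrix.hadamard_apply, Matrix.of_apply, Matrix.one_apply]
  split_ifs with h
  · rw [one_mul]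
    norm_cast
    refine Nat.card_congr (Equiv.subtypeEquivRight fun f => ?_)
    constructor
    · rintro ⟨⟨hE, hQ⟩, hab⟩
      exact ⟨⟨hE, fun x y hxy => hQ x y (.inl hxy)⟩, hab⟩
    · rintro ⟨⟨hE, hQ⟩, ha, hb⟩
      refine ⟨⟨hE, ?_⟩, ha, hb⟩
      rintro x y (hxy | ⟨rfl, rfl⟩)
      · exact hQ x y hxy
      · rw [ha, hb, h]
  · rw [zero_mul]
    have : IsEmpty {f : U → V // RelHom E (fun x y => Q x y ∨ x = a ∧ y = b) G f ∧
        f a = u ∧ f b = v} :=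
      ⟨fun ⟨f, hf, ha, hb⟩ => h (by rw [← ha, ← hb]; exact hf.2 a b (.inr ⟨rfl, rfl⟩))⟩
    simp

theorem relHomMatrix_add_adj {U V : Type*} (E Q : U → U → Prop) (G : SimpleGraph V)
    [DecidableRel G.Adj] (a b : U) :
    relHomMatrix (fun x y => E x y ∨ x = a ∧ y = b) Q G a b =
      G.adjMatrix ℝ ⊙ relHomMatrix E Q G a b := by
  ext u v
  simp only [relHomMatrix, Matrix.hadamard_apply, Matrix.of_apply, SimpleGraph.adjMatrix_apply]
  split_ifs with h
  · rw [one_mul]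
    norm_cast
    refine Nat.card_congr (Equiv.subtypeEquivRight fun f => ?_)
    constructor
    · rintro ⟨⟨hE, hQ⟩, hab⟩
      exact ⟨⟨fun x y hxy => hE x y (.inl hxy), hQ⟩, hab⟩
    · rintro ⟨⟨hE, hQ⟩, ha, hb⟩
      refine ⟨⟨?_, hQ⟩, ha, hb⟩
      rintro x y (hxy | ⟨rfl, rfl⟩)
      · exact hE x y hxy
      · rwa [ha, hb]
  · rw [zero_mul]
    have : IsEmpty {f : U → V // RelHom (fun x y => E x y ∨ x = a ∧ y = b) Q G f ∧
        f a = u ∧ f b = v} :=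
      ⟨fun ⟨f, hf, ha, hb⟩ => h (by rw [← ha, ← hb]; exact hf.1 a b (.inr ⟨rfl, rfl⟩))⟩
    simp

theorem card_eq_sum_card_fiber {α V : Type*} [Finite α] [Fintype V] (f g : α → V) :
    (Nat.card α : ℝ) = ∑ u, ∑ v, (Nat.card {x : α // f x = u ∧ g x = v} : ℝ) := by
  norm_cast
  rw [← Fintype.sum_prod_type', ← Nat.card_sigma]
  refine Nat.card_congr
    { toFun := fun x => ⟨(f x, g x), x, rfl, rfl⟩
      invFun := fun z => z.2.1
      left_inv := fun _ => rfl
      right_inv := ?_ }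
  rintro ⟨⟨u, v⟩, x, hu, hv⟩
  dsimp at hu hv
  subst hu hv
  rfl

theorem entrySum_relHomMatrix {U V : Type*} [Finite U] [Fintype V] (E Q : U → U → Prop)
    (G : SimpleGraph V) (a b : U) :
    entrySum (relHomMatrix E Q G a b) = Nat.card {f : U → V // RelHom E Q G f} := by
  rw [card_eq_sum_card_fiber (fun f : {f : U → V // RelHom E Q G f} => f.1 a) (fun f => f.1 b)]
  simp only [entrySum, relHomMatrix, Matrix.of_apply]
  refine Finset.sum_congr rfl fun u _ => Finset.sum_congr rfl fun v _ => ?_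
  norm_cast
  exact (Nat.card_congr (Equiv.subtypeSubtypeEquivSubtypeInter _ _)).symm

/-- No two pairs in `R` cross when the elements are placed on a line according to `pos`, and `a`
is the first and `b` is the last element. -/
structure NoncrossingBetween {U : Type*} (R : U → U → Prop) (pos : U → ℕ) (a b : U) : Prop where
  injective : Function.Injective pos
  le_pos : ∀ x, pos a ≤ pos x
  pos_le : ∀ x, pos x ≤ pos b
  not_cross : ∀ x y z w, R x y ∨ R y x → R z w ∨ R w z →
    pos x < pos z → pos z < pos y → ¬ pos y < pos w

/-- A pair formed by the first and the last element crosses nothing. -/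
theorem NoncrossingBetween.of_add {U : Type*} {R R' : U → U → Prop} {pos : U → ℕ} {a b : U}
    (h : NoncrossingBetween R pos a b) (hR : ∀ x y, R' x y → R x y ∨ x = a ∧ y = b) :
    NoncrossingBetween R' pos a b := by
  have hle := h.le_pos
  have hge := h.pos_le
  refine ⟨h.injective, hle, hge, fun x y z w hxy hzw h1 h2 h3 => ?_⟩
  have hxy' : R x y ∨ R y x := by
    rcases hxy with hxy | hxy
    · rcases hR _ _ hxy with h' | ⟨rfl, rfl⟩
      · exact .inl h'
      · have := hge w; omega
    · rcases hR _ _ hxy with h' | ⟨rfl, rfl⟩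
      · exact .inr h'
      · have := hge z; omega
  have hzw' : R z w ∨ R w z := by
    rcases hzw with hzw | hzw
    · rcases hR _ _ hzw with h' | ⟨rfl, rfl⟩
      · exact .inl h'
      · have := hle x; omega
    · rcases hR _ _ hzw with h' | ⟨rfl, rfl⟩
      · exact .inr h'
      · have := hge y; omega
  exact h.not_cross x y z w hxy' hzw' h1 h2 h3

/-- The shift by `pos b + 1` puts the second line strictly after the first. The joining pair then
consists of neighbours on the line, so nothing lies between them. -/
theorem NoncrossingBetween.series {U U' : Type*} {R : U → U → Prop} {R' : U' → U' → Prop}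
    {pos : U → ℕ} {pos' : U' → ℕ} {a b : U} {a' b' : U'} (h : NoncrossingBetween R pos a b)
    (h' : NoncrossingBetween R' pos' a' b') :
    NoncrossingBetween (SeriesRel R R' fun x y => x = b ∧ y = a')
      (Sum.elim pos fun y => pos b + 1 + pos' y) (.inl a) (.inr b') := by
  have hge := h.pos_le
  have hle' := h'.le_pos
  refine ⟨?_, ?_, ?_, ?_⟩
  · rintro (x | x) (y | y) hxy
    · exact congrArg _ (h.injective hxy)
    · have := hge x; simp only [Sum.elim_inl, Sum.elim_inr] at hxy; omega
    · have := hge y; simp only [Sum.elim_inl, Sum.elim_inr] at hxy; omega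
    · simp only [Sum.elim_inr] at hxy
      exact congrArg _ (h'.injective (by omega))
  · rintro (x | x)
    · exact h.le_pos x
    · have := hge a; simp only [Sum.elim_inl, Sum.elim_inr]; omega
  · rintro (x | x)
    · have := hge x; simp only [Sum.elim_inl, Sum.elim_inr]; omega
    · have := h'.pos_le x; simp only [Sum.elim_inr]; omega
  · have hs : ∀ p q : U ⊕ U', SeriesRel R R' (fun x y => x = b ∧ y = a') p q ∨
        SeriesRel R R' (fun x y => x = b ∧ y = a') q p →
        (∃ x y, p = .inl x ∧ q = .inl y ∧ (R x y ∨ R y x)) ∨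
        (∃ x y, p = .inr x ∧ q = .inr y ∧ (R' x y ∨ R' y x)) ∨
        (p = .inl b ∧ q = .inr a') ∨ (p = .inr a' ∧ q = .inl b) := by
      rintro p q ((h | h | ⟨rfl, rfl⟩) | (h | h | ⟨rfl, rfl⟩))
      · exact .inl ⟨_, _, rfl, rfl, .inl h⟩
      · exact .inr (.inl ⟨_, _, rfl, rfl, .inl h⟩)
      · exact .inr (.inr (.inl ⟨rfl, rfl⟩))
      · exact .inl ⟨_, _, rfl, rfl, .inr h⟩
      · exact .inr (.inl ⟨_, _, rfl, rfl, .inr h⟩)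
      · exact .inr (.inr (.inr ⟨rfl, rfl⟩))
    intro p q r s hpq hrs
    rcases hs p q hpq with
      ⟨x, y, rfl, rfl, hxy⟩ | ⟨x, y, rfl, rfl, hxy⟩ | ⟨rfl, rfl⟩ | ⟨rfl, rfl⟩ <;>
    rcases hs r s hrs with
      ⟨z, w, rfl, rfl, hzw⟩ | ⟨z, w, rfl, rfl, hzw⟩ | ⟨rfl, rfl⟩ | ⟨rfl, rfl⟩ <;>
    simp only [Sum.elim_inl, Sum.elim_inr] <;> intro h1 h2 h3
    · exact h.not_cross x y z w hxy hzw h1 h2 h3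
    · have := hge y; omega
    · have := hge y; omega
    · have := hge y; omega
    · have := hge z; omega
    · exact h'.not_cross x y z w hxy hzw (by omega) (by omega) (by omega)
    · have := hge b; omega
    · have := hle' x; omega
    · have := hge z; omega
    · have := hle' z; omega
    · omega
    · omega
    · have := hge z; omega
    · have := hle' z; omega
    · omega
    · omega

variable {G : SimpleGraph V} {H : SimpleGraph W} [DecidableRel G.Adj] [DecidableRel H.Adj]

/-- Identifications are only recorded in `Q`, so that all vertices keep separate places on the line;
contraction is postponed until after the noncrossing drawing is known. -/
theorem MatrixPair.exists_noncrossing {X : Matrix V V ℝ} {Y : Matrix W W ℝ}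
    (h : MatrixPair G H X Y) :
    ∃ (U : Type) (_ : Finite U) (E Q : U → U → Prop) (pos : U → ℕ) (a b : U),
      NoncrossingBetween (fun x y => E x y ∨ Q x y) pos a b ∧
      X = relHomMatrix E Q G a b ∧ Y = relHomMatrix E Q H a b := by
  induction h with
  | ones =>
    refine ⟨Fin 2, inferInstance, fun _ _ => False, fun _ _ => False, fun x => x.1, 0, 1,
      ⟨Fin.val_injective, fun x => Nat.zero_le _, fun x => by simp; omega, by simp⟩, ?_, ?_⟩
    · ext u v
      simp only [relHomMatrix, Matrix.of_apply, onesMatrix_apply]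
      norm_cast
      rw [eq_comm, Nat.card_eq_one_iff_unique]
      refine ⟨⟨fun f g => Subtype.ext (funext fun i => ?_)⟩, ⟨![u, v], by simp [RelHom]⟩⟩
      fin_cases i
      · exact f.2.2.1.trans g.2.2.1.symm
      · exact f.2.2.2.trans g.2.2.2.symm
    · ext u v
      simp only [relHomMatrix, Matrix.of_apply, onesMatrix_apply]
      norm_cast
      rw [eq_comm, Nat.card_eq_one_iff_unique]
      refine ⟨⟨fun f g => Subtype.ext (funext fun i => ?_)⟩, ⟨![u, v], by simp [RelHom]⟩⟩
      fin_cases i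
      · exact f.2.2.1.trans g.2.2.1.symm
      · exact f.2.2.2.trans g.2.2.2.symm
  | mul _ _ ih ih' =>
    obtain ⟨U, _, E, Q, pos, a, b, hnc, rfl, rfl⟩ := ih
    obtain ⟨U', _, E', Q', pos', a', b', hnc', rfl, rfl⟩ := ih'
    refine ⟨U ⊕ U', inferInstance, SeriesRel E E' fun _ _ => False,
      SeriesRel Q Q' fun x y => x = b ∧ y = a', _, .inl a, .inr b',
      (hnc.series hnc').of_add ?_, (relHomMatrix_series ..).symm, (relHomMatrix_series ..).symm⟩
    rintro _ _ ((h | h | h) | (h | h | h))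
    · exact .inl (.left (.inl h))
    · exact .inl (.right (.inl h))
    · exact h.elim
    · exact .inl (.left (.inr h))
    · exact .inl (.right (.inr h))
    · exact .inl (.join h)
  | hadamard_one _ ih =>
    obtain ⟨U, _, E, Q, pos, a, b, hnc, rfl, rfl⟩ := ih
    exact ⟨U, inferInstance, E, fun x y => Q x y ∨ x = a ∧ y = b, pos, a, b,
      hnc.of_add (by tauto), (relHomMatrix_add_eq ..).symm, (relHomMatrix_add_eq ..).symm⟩
  | hadamard_adjMatrix _ ih =>
    obtain ⟨U, _, E, Q, pos, a, b, hnc, rfl, rfl⟩ := ih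
    exact ⟨U, inferInstance, fun x y => E x y ∨ x = a ∧ y = b, Q, pos, a, b,
      hnc.of_add (by tauto), (relHomMatrix_add_adj ..).symm, (relHomMatrix_add_adj ..).symm⟩

theorem HomIndistinguishable.entrySum_eq (hGH : HomIndistinguishable outerplanarGraphs G H)
    {X : Matrix V V ℝ} {Y : Matrix W W ℝ} (h : MatrixPair G H X Y) :
    entrySum X = entrySum Y := by
  obtain ⟨U, _, E, Q, pos, a, b, hnc, rfl, rfl⟩ := h.exists_noncrossing
  rw [entrySum_relHomMatrix, entrySum_relHomMatrix]
  norm_cast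
  by_cases hE : ∀ x y, E x y → Quot.mk Q x ≠ Quot.mk Q y
  · rw [card_relHom_eq_card_hom G hE, card_relHom_eq_card_hom H hE]
    have hR : IsNoncrossing (SimpleGraph.fromRel fun x y => E x y ∨ Q x y) pos :=
      ⟨hnc.injective, fun x y z w hxy hzw => hnc.not_cross x y z w hxy.2 hzw.2⟩
    exact hGH _ _ hR.isOuterplanar.quotGraph
  · rw [card_relHom_eq_zero G hE, card_relHom_eq_zero H hE]

end Representation

/-! ### Components of induced subgraphs. -/

section Component

variable {U : Type*} {F : SimpleGraph U}

/-- The component of `b` in the subgraph of `F` induced by `T` (for `b ∈ T`). -/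
def comp (F : SimpleGraph U) (T : Set U) (b : U) : Set U :=
  {y | Relation.ReflTransGen (fun x y => F.Adj x y ∧ y ∈ T) b y}

theorem mem_comp_self (T : Set U) (b : U) : b ∈ comp F T b := Relation.ReflTransGen.refl

theorem comp_closed {T : Set U} {b x y : U} (hx : x ∈ comp F T b) (hxy : F.Adj x y) (hy : y ∈ T) :
    y ∈ comp F T b := Relation.ReflTransGen.tail hx ⟨hxy, hy⟩

theorem comp_subset_of_closed {T Z : Set U} {b : U} (hb : b ∈ Z)
    (h : ∀ x ∈ Z, ∀ y ∈ T, F.Adj x y → y ∈ Z) : comp F T b ⊆ Z := by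
  intro y hy
  induction hy with
  | refl => exact hb
  | tail _ hxy ih => exact h _ ih _ hxy.2 hxy.1

theorem comp_subset {T : Set U} {b : U} (hb : b ∈ T) : comp F T b ⊆ T :=
  comp_subset_of_closed hb fun _ _ _ hy _ => hy

theorem comp_mono {T T' : Set U} (h : T ⊆ T') (b : U) : comp F T b ⊆ comp F T' b :=
  comp_subset_of_closed (mem_comp_self _ _) fun _ hx _ hy hxy => comp_closed hx hxy (h hy)

theorem mem_comp_comm {T : Set U} {b y : U} (hb : b ∈ T) (hy : y ∈ comp F T b) :
    b ∈ comp F T y := by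
  have : comp F T b ⊆ {y | y ∈ T ∧ b ∈ comp F T y} := by
    refine comp_subset_of_closed ⟨hb, mem_comp_self _ _⟩ ?_
    rintro x ⟨hxT, hx⟩ y hy hxy
    exact ⟨hy, Relation.ReflTransGen.head ⟨hxy.symm, hxT⟩ hx⟩
  exact (this hy).2

theorem comp_eq_of_mem {T : Set U} {b y : U} (hb : b ∈ T) (hy : y ∈ comp F T b) :
    comp F T y = comp F T b := by
  refine Set.Subset.antisymm ?_ ?_
  · exact comp_subset_of_closed hy fun _ hx _ hy hxy => comp_closed hx hxy hy
  · exact comp_subset_of_closed (mem_comp_comm hb hy) fun _ hx _ hy hxy => comp_closed hx hxy hy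

theorem connOn_comp (T : Set U) {b : U} (hb : b ∈ T) : ConnOn F (comp F T b) := by
  refine ⟨⟨b, mem_comp_self _ _⟩, ?_⟩
  rintro Z ⟨x, hx, hxZ⟩ hcl
  rw [← comp_eq_of_mem hb hx]
  have hxT := comp_subset hb hx
  refine (comp_subset_of_closed (Z := Z ∩ comp F T b) ⟨hxZ, hx⟩ ?_).trans Set.inter_subset_left
  rintro y ⟨hyZ, hy⟩ z hz hyz
  have hz' := comp_closed hy hyz hz
  exact ⟨hcl y hy hyZ z hz' hyz, hz'⟩

theorem ConnOn.subset_comp {S T : Set U} (hS : ConnOn F S) (hST : S ⊆ T) {b z : U} (hz : z ∈ S)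
    (hzb : z ∈ comp F T b) : S ⊆ comp F T b :=
  hS.2 _ ⟨z, hz, hzb⟩ fun _ _ hx _ hy hxy => comp_closed hx hxy (hST hy)

/-- If no neighbour of `y` were reached without using `y`, the component in `T \ {y}` would already
be closed in `T`, and `y` would lie in it. -/
theorem exists_adj_comp_diff {T : Set U} {b y : U} (hb : b ∈ T) (hy : y ∈ comp F T b)
    (hne : y ≠ b) : ∃ z ∈ comp F (T \ {y}) b, F.Adj z y := by
  by_contra hcon
  push Not at hcon
  have h1 : comp F T b ⊆ comp F (T \ {y}) b := by
    refine comp_subset_of_closed (mem_comp_self _ _) fun x hx z hz hxz => ?_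
    refine comp_closed hx hxz ⟨hz, ?_⟩
    rintro rfl
    exact hcon x hx hxz
  exact (comp_subset (T := T \ {y}) ⟨hb, hne.symm⟩ (h1 hy)).2 rfl

theorem ConnOn.exists_adj_comp_diff {A : Set U} (hA : ConnOn F A) {a z : U} (ha : a ∈ A)
    (hz : z ∈ A) (hne : a ≠ z) : ∃ q ∈ comp F (A \ {a}) z, F.Adj q a :=
  LasserreIso.exists_adj_comp_diff hz (hA.subset_comp subset_rfl hz (mem_comp_self _ _) ha) hne

theorem ConnOn.mono {F' : SimpleGraph U} (h : F ≤ F') {S : Set U} (hS : ConnOn F S) :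
    ConnOn F' S :=
  ⟨hS.1, fun T hT hcl => hS.2 T hT fun x hx hxT y hy hxy => hcl x hx hxT y hy (h hxy)⟩

end Component

/-! ### Excluded minors and the choice of labels. -/

section Minors

variable {U : Type*} {F : SimpleGraph U}

/-- Some edge of `F` joins `A` to `B`. -/
def Touches (F : SimpleGraph U) (A B : Set U) : Prop := ∃ x ∈ A, ∃ y ∈ B, F.Adj x y

theorem Touches.symm {A B : Set U} (h : Touches F A B) : Touches F B A := by
  obtain ⟨x, hx, y, hy, hxy⟩ := h
  exact ⟨y, hy, x, hx, hxy.symm⟩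

theorem Touches.mono {A A' B B' : Set U} (h : Touches F A B) (hA : A ⊆ A') (hB : B ⊆ B') :
    Touches F A' B' := by
  obtain ⟨x, hx, y, hy, hxy⟩ := h
  exact ⟨x, hA hx, y, hB hy, hxy⟩

theorem IsOuterplanar.mono {F' : SimpleGraph U} (h : F' ≤ F) (hF : IsOuterplanar F) :
    IsOuterplanar F' := by
  have : ∀ {N : Type} (K : SimpleGraph N), IsMinor K F' → IsMinor K F := by
    rintro N K ⟨B, hconn, hdisj, hadj⟩
    refine ⟨B, fun u => ?_, hdisj, fun u u' huu => ?_⟩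
    · exact connOn_iff_induce_connected.1 ((connOn_iff_induce_connected.2 (hconn u)).mono h)
    · obtain ⟨x, hx, y, hy, hxy⟩ := hadj u u' huu
      exact ⟨x, hx, y, hy, h hxy⟩
  exact ⟨fun h' => hF.1 (this _ h'), fun h' => hF.2 (this _ h')⟩

theorem IsOuterplanar.not_K4 (hF : IsOuterplanar F) {A B X Y : Set U} (hA : ConnOn F A)
    (hB : ConnOn F B) (hX : ConnOn F X) (hY : ConnOn F Y) (dAB : Disjoint A B)
    (dAX : Disjoint A X) (dAY : Disjoint A Y) (dBX : Disjoint B X) (dBY : Disjoint B Y)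
    (dXY : Disjoint X Y) (tAB : Touches F A B) (tAX : Touches F A X) (tAY : Touches F A Y)
    (tBX : Touches F B X) (tBY : Touches F B Y) (tXY : Touches F X Y) : False := by
  refine hF.1 ⟨![A, B, X, Y], ?_, ?_, ?_⟩
  · intro i
    rw [← connOn_iff_induce_connected]
    fin_cases i <;> assumption
  · intro i j hij
    fin_cases i <;> fin_cases j <;>
      first | exact absurd rfl hij | assumption | (apply Disjoint.symm; assumption)
  · intro i j hij
    have hij := hij.ne
    fin_cases i <;> fin_cases j <;>
      first | exact absurd rfl hij | assumption | (apply Touches.symm; assumption)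

theorem IsOuterplanar.not_K23 (hF : IsOuterplanar F) {A B X Y Z : Set U} (hA : ConnOn F A)
    (hB : ConnOn F B) (hX : ConnOn F X) (hY : ConnOn F Y) (hZ : ConnOn F Z) (dAB : Disjoint A B)
    (dAX : Disjoint A X) (dAY : Disjoint A Y) (dAZ : Disjoint A Z) (dBX : Disjoint B X)
    (dBY : Disjoint B Y) (dBZ : Disjoint B Z) (dXY : Disjoint X Y) (dXZ : Disjoint X Z)
    (dYZ : Disjoint Y Z) (tAX : Touches F A X) (tAY : Touches F A Y) (tAZ : Touches F A Z)
    (tBX : Touches F B X) (tBY : Touches F B Y) (tBZ : Touches F B Z) : False := by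
  refine hF.2 ⟨Sum.elim ![A, B] ![X, Y, Z], ?_, ?_, ?_⟩
  · intro i
    rw [← connOn_iff_induce_connected]
    rcases i with i | i <;> fin_cases i <;> assumption
  · intro i j hij
    rcases i with i | i <;> rcases j with j | j <;> fin_cases i <;> fin_cases j <;>
      first | exact absurd rfl hij | assumption | (apply Disjoint.symm; assumption)
  · intro i j hij
    rcases i with i | i <;> rcases j with j | j
    · simp at hij
    · fin_cases i <;> fin_cases j <;> assumption
    · fin_cases i <;> fin_cases j <;> (apply Touches.symm; assumption)
    · simp at hij

/-- Inside `S`, there are disjoint connected sets containing `a` and `b`, respectively, and two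
further disjoint connected sets that are joined by edges to both of them. -/
def HasTheta (F : SimpleGraph U) (S : Set U) (a b : U) : Prop :=
  ∃ A B X Y : Set U, (A ⊆ S ∧ B ⊆ S ∧ X ⊆ S ∧ Y ⊆ S) ∧
    (ConnOn F A ∧ ConnOn F B ∧ ConnOn F X ∧ ConnOn F Y) ∧
    (Disjoint A B ∧ Disjoint A X ∧ Disjoint A Y ∧ Disjoint B X ∧ Disjoint B Y ∧ Disjoint X Y) ∧
    (a ∈ A ∧ b ∈ B) ∧ Touches F A X ∧ Touches F A Y ∧ Touches F B X ∧ Touches F B Y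

theorem HasTheta.mono_graph {F' : SimpleGraph U} (h : F ≤ F') {S : Set U} {a b : U}
    (ht : HasTheta F S a b) : HasTheta F' S a b := by
  have hT : ∀ {A B}, Touches F A B → Touches F' A B := by
    rintro A B ⟨x, hx, y, hy, hxy⟩; exact ⟨x, hx, y, hy, h hxy⟩
  obtain ⟨A, B, X, Y, hsub, ⟨hA, hB, hX, hY⟩, hd, hab, t1, t2, t3, t4⟩ := ht
  exact ⟨A, B, X, Y, hsub, ⟨hA.mono h, hB.mono h, hX.mono h, hY.mono h⟩, hd, hab,
    hT t1, hT t2, hT t3, hT t4⟩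

theorem touches_comp_of_mem {X R : Set U} {x z : U} (hx : x ∈ X) (hz : z ∈ R)
    (hXR : Disjoint X R) (h : z ∈ comp F (X ∪ R) x) : Touches F (comp F R z) X := by
  by_contra hcon
  have h1 : comp F (X ∪ R) z ⊆ comp F R z := by
    refine comp_subset_of_closed (mem_comp_self _ _) fun p hp q hq hpq => ?_
    rcases hq with hq | hq
    · exact absurd ⟨p, hp, q, hq, hpq⟩ hcon
    · exact comp_closed hp hpq hq
  exact Set.disjoint_left.1 hXR hx (comp_subset hz (h1 (mem_comp_comm (.inl hx) h)))

/-- Shrinks the branch set `A` to its vertex `a`, letting `X` and `Y` absorb the components of `A \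
{a}` that they reach. If both reached the same component, that component and `B` would each touch
`X`, `Y` and `{a}`: a `K₂,₃` minor. -/
theorem IsOuterplanar.exists_touches_singleton (hF : IsOuterplanar F) {A B X Y : Set U}
    (hA : ConnOn F A) (hB : ConnOn F B) (hX : ConnOn F X) (hY : ConnOn F Y) (dAB : Disjoint A B)
    (dAX : Disjoint A X) (dAY : Disjoint A Y) (dBX : Disjoint B X) (dBY : Disjoint B Y)
    (dXY : Disjoint X Y) {a : U} (ha : a ∈ A) (taB : Touches F {a} B) (tAX : Touches F A X)
    (tAY : Touches F A Y) (tBX : Touches F B X) (tBY : Touches F B Y) :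
    ∃ X' Y' : Set U, (X ⊆ X' ∧ X' ⊆ X ∪ A \ {a}) ∧ (Y ⊆ Y' ∧ Y' ⊆ Y ∪ A \ {a}) ∧
      ConnOn F X' ∧ ConnOn F Y' ∧ Disjoint X' Y' ∧ Touches F {a} X' ∧ Touches F {a} Y' := by
  have hgrow : ∀ {X : Set U}, ConnOn F X → Touches F A X → ∀ x ∈ X,
      (X ⊆ comp F (X ∪ A \ {a}) x ∧ comp F (X ∪ A \ {a}) x ⊆ X ∪ A \ {a}) ∧
      ConnOn F (comp F (X ∪ A \ {a}) x) ∧ Touches F {a} (comp F (X ∪ A \ {a}) x) := by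
    intro X hX tAX x hx
    have h1 : X ⊆ comp F (X ∪ A \ {a}) x :=
      hX.subset_comp Set.subset_union_left hx (mem_comp_self _ _)
    refine ⟨⟨h1, comp_subset (.inl hx)⟩, connOn_comp _ (.inl hx), ?_⟩
    obtain ⟨p, hp, q, hq, hpq⟩ := tAX
    by_cases hpa : p = a
    · exact ⟨a, rfl, q, h1 hq, hpa ▸ hpq⟩
    · have hpA : p ∈ A \ {a} := ⟨hp, hpa⟩
      obtain ⟨z, hz, hza⟩ := hA.exists_adj_comp_diff ha hp (Ne.symm hpa)
      refine ⟨a, rfl, z, ?_, hza.symm⟩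
      have hpc : p ∈ comp F (X ∪ A \ {a}) x := comp_closed (h1 hq) hpq.symm (.inr hpA)
      exact (connOn_comp (F := F) (A \ {a}) hpA).subset_comp
        ((comp_subset hpA).trans Set.subset_union_right) (mem_comp_self _ _) hpc hz
  obtain ⟨x, hx⟩ := hX.1
  obtain ⟨y, hy⟩ := hY.1
  obtain ⟨⟨hX1, hX2⟩, hX3, hX4⟩ := hgrow hX tAX x hx
  obtain ⟨⟨hY1, hY2⟩, hY3, hY4⟩ := hgrow hY tAY y hy
  refine ⟨_, _, ⟨hX1, hX2⟩, ⟨hY1, hY2⟩, hX3, hY3, ?_, hX4, hY4⟩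
  rw [Set.disjoint_left]
  intro z hzX hzY
  have dX : Disjoint X (A \ {a}) := dAX.symm.mono_right Set.sdiff_subset
  have dY : Disjoint Y (A \ {a}) := dAY.symm.mono_right Set.sdiff_subset
  have hzA : z ∈ A \ {a} := by
    rcases hX2 hzX with h | h
    · rcases hY2 hzY with h' | h'
      · exact absurd h' (Set.disjoint_left.1 dXY h)
      · exact h'
    · exact h
  have hQ : comp F (A \ {a}) z ⊆ A \ {a} := comp_subset hzA
  obtain ⟨q, hq, hqa⟩ := hA.exists_adj_comp_diff ha hzA.1 fun h => hzA.2 h.symm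
  have daX : Disjoint X {a} := Set.disjoint_singleton_right.2 fun h =>
    Set.disjoint_left.1 dAX ha h
  have daY : Disjoint Y {a} := Set.disjoint_singleton_right.2 fun h =>
    Set.disjoint_left.1 dAY ha h
  have daB : Disjoint B {a} := Set.disjoint_singleton_right.2 fun h =>
    Set.disjoint_left.1 dAB ha h
  exact hF.not_K23 (connOn_comp _ hzA) hB hX hY (connOn_singleton a)
    (dAB.mono_left (hQ.trans Set.sdiff_subset)) (dX.symm.mono_left hQ) (dY.symm.mono_left hQ)
    (Set.disjoint_singleton_right.2 fun h => (hQ h).2 rfl) dBX dBY daB dXY daX daY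
    (touches_comp_of_mem hx hzA dX hzX) (touches_comp_of_mem hy hzA dY hzY)
    ⟨q, hq, a, rfl, hqa⟩ tBX tBY taB.symm

/-- Both end sets of the theta shrink to `{a}` and `{b}`. If the two middle sets were still
connected to each other outside `a` and `b`, then with the edge `ab` they would give a `K₄` minor.
-/
theorem IsOuterplanar.exists_two_components (hF : IsOuterplanar F) {S : Set U} {a b : U}
    (hab : F.Adj a b) (ht : HasTheta F S a b) :
    ∃ x ∈ S \ {a, b}, ∃ y ∈ S \ {a, b}, y ∉ comp F (S \ {a, b}) x ∧
      Touches F {a} (comp F (S \ {a, b}) x) ∧ Touches F {b} (comp F (S \ {a, b}) x) ∧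
      Touches F {a} (comp F (S \ {a, b}) y) ∧ Touches F {b} (comp F (S \ {a, b}) y) := by
  obtain ⟨A, B, X, Y, ⟨sA, sB, sX, sY⟩, ⟨hA, hB, hX, hY⟩, ⟨dAB, dAX, dAY, dBX, dBY, dXY⟩,
    ⟨ha, hb⟩, tAX, tAY, tBX, tBY⟩ := ht
  obtain ⟨X₁, Y₁, ⟨hX1, hX1'⟩, ⟨hY1, hY1'⟩, cX1, cY1, dXY1, taX1, taY1⟩ :=
    hF.exists_touches_singleton hA hB hX hY dAB dAX dAY dBX dBY dXY ha
      ⟨a, rfl, b, hb, hab⟩ tAX tAY tBX tBY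
  have haX : a ∉ X := Set.disjoint_left.1 dAX ha
  have haY : a ∉ Y := Set.disjoint_left.1 dAY ha
  have haB : a ∉ B := Set.disjoint_left.1 dAB ha
  have haX1 : a ∉ X₁ := fun h => (hX1' h).elim haX fun h => h.2 rfl
  have haY1 : a ∉ Y₁ := fun h => (hY1' h).elim haY fun h => h.2 rfl
  have dBX1 : Disjoint B X₁ := Disjoint.mono_right hX1'
    (Set.disjoint_union_right.2 ⟨dBX, dAB.symm.mono_right Set.sdiff_subset⟩)
  have dBY1 : Disjoint B Y₁ := Disjoint.mono_right hY1'
    (Set.disjoint_union_right.2 ⟨dBY, dAB.symm.mono_right Set.sdiff_subset⟩)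
  obtain ⟨X₂, Y₂, ⟨hX2, hX2'⟩, ⟨hY2, hY2'⟩, cX2, cY2, dXY2, tbX2, tbY2⟩ :=
    hF.exists_touches_singleton hB (connOn_singleton a) cX1 cY1
      (Set.disjoint_singleton_right.2 haB) dBX1 dBY1 (Set.disjoint_singleton_left.2 haX1)
      (Set.disjoint_singleton_left.2 haY1) dXY1 hb ⟨b, rfl, a, rfl, hab.symm⟩
      (tBX.mono subset_rfl hX1) (tBY.mono subset_rfl hY1) taX1 taY1
  have taX2 := taX1.mono subset_rfl hX2
  have taY2 := taY1.mono subset_rfl hY2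
  have hbX1 : b ∉ X₁ := Set.disjoint_left.1 dBX1 hb
  have hbY1 : b ∉ Y₁ := Set.disjoint_left.1 dBY1 hb
  have sX2 : X₂ ⊆ S \ {a, b} := by
    intro z hz
    rcases hX2' hz with h | h
    · refine ⟨(hX1' h).elim (fun h => sX h) fun h => sA h.1, ?_⟩
      rintro (rfl | rfl)
      · exact haX1 h
      · exact hbX1 h
    · refine ⟨sB h.1, ?_⟩
      rintro (rfl | rfl)
      · exact haB h.1
      · exact h.2 rfl
  have sY2 : Y₂ ⊆ S \ {a, b} := by
    intro z hz
    rcases hY2' hz with h | h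
    · refine ⟨(hY1' h).elim (fun h => sY h) fun h => sA h.1, ?_⟩
      rintro (rfl | rfl)
      · exact haY1 h
      · exact hbY1 h
    · refine ⟨sB h.1, ?_⟩
      rintro (rfl | rfl)
      · exact haB h.1
      · exact h.2 rfl
  obtain ⟨x, hx⟩ := cX2.1
  obtain ⟨y, hy⟩ := cY2.1
  have hXc := cX2.subset_comp sX2 hx (mem_comp_self _ _)
  have hYc := cY2.subset_comp sY2 hy (mem_comp_self _ _)
  refine ⟨x, sX2 hx, y, sY2 hy, fun hyx => ?_, taX2.mono subset_rfl hXc,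
    tbX2.mono subset_rfl hXc, taY2.mono subset_rfl hYc, tbY2.mono subset_rfl hYc⟩
  have hxT : x ∈ (S \ {a, b}) \ Y₂ := ⟨sX2 hx, Set.disjoint_left.1 dXY2 hx⟩
  have hW := comp_subset (F := F) hxT
  have hXW : X₂ ⊆ comp F ((S \ {a, b}) \ Y₂) x :=
    cX2.subset_comp (Set.subset_sdiff.2 ⟨sX2, dXY2⟩) hx (mem_comp_self _ _)
  have tWY : Touches F (comp F ((S \ {a, b}) \ Y₂) x) Y₂ := by
    by_contra hcon
    have h1 : comp F (S \ {a, b}) x ⊆ comp F ((S \ {a, b}) \ Y₂) x := by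
      refine comp_subset_of_closed (mem_comp_self _ _) fun p hp q hq hpq => ?_
      exact comp_closed hp hpq ⟨hq, fun hqY => hcon ⟨p, hp, q, hqY, hpq⟩⟩
    exact (hW (h1 hyx)).2 hy
  refine hF.not_K4 (connOn_singleton a) (connOn_singleton b) (connOn_comp _ hxT) cY2
    (by simpa using hab.ne) ?_ ?_ ?_ ?_ ?_ ⟨a, rfl, b, rfl, hab⟩
    (taX2.mono subset_rfl hXW) taY2 (tbX2.mono subset_rfl hXW) tbY2 tWY
  · exact Set.disjoint_singleton_left.2 fun h => (hW h).1.2 (.inl rfl)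
  · exact Set.disjoint_singleton_left.2 fun h => (sY2 h).2 (.inl rfl)
  · exact Set.disjoint_singleton_left.2 fun h => (hW h).1.2 (.inr rfl)
  · exact Set.disjoint_singleton_left.2 fun h => (sY2 h).2 (.inr rfl)
  · exact Set.disjoint_left.2 fun z hz => (hW hz).2

/-- Otherwise take a neighbour `b` of `a` and a component of `S \ {a, b}` touching both, as large as
possible. A second such component contains a neighbour `b'` of `a`; deleting `b'` instead of `b`
leaves `b` attached to the first component, giving a larger one. -/
theorem IsOuterplanar.exists_not_hasTheta [Finite U] (hF : IsOuterplanar F) {S : Set U} {a z : U}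
    (ha : a ∈ S) (hz : z ∈ S) (hza : z ≠ a) : ∃ b ∈ S, b ≠ a ∧ ¬ HasTheta F S a b := by
  by_cases hnb : ∃ b ∈ S, F.Adj a b
  swap
  · push Not at hnb
    refine ⟨z, hz, hza, ?_⟩
    rintro ⟨A, B, X, Y, ⟨sA, -, sX, -⟩, ⟨hA, -, -, -⟩, -, ⟨haA, -⟩, ⟨p, hp, q, hq, hpq⟩, -⟩
    have : A ⊆ {a} := hA.2 {a} ⟨a, haA, rfl⟩ (by
      rintro x _ rfl y hy hxy
      exact absurd hxy (hnb y (sA hy)))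
    obtain rfl := this hp
    exact hnb q (sX hq) hpq
  by_contra! hcon
  have hth : ∀ b ∈ S, F.Adj a b → HasTheta F S a b := fun b hb hab => hcon b hb hab.ne'
  let P : Set (U × U) := {p | p.1 ∈ S ∧ F.Adj a p.1 ∧ p.2 ∈ S \ {a, p.1} ∧
    Touches F {a} (comp F (S \ {a, p.1}) p.2) ∧ Touches F {p.1} (comp F (S \ {a, p.1}) p.2)}
  obtain ⟨b₀, hb₀, hab₀⟩ := hnb
  have hP : P.Nonempty := by
    obtain ⟨x, hx, -, -, -, t1, t2, -⟩ := hF.exists_two_components hab₀ (hth b₀ hb₀ hab₀)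
    exact ⟨(b₀, x), hb₀, hab₀, hx, t1, t2⟩
  obtain ⟨⟨b, x⟩, ⟨hb, hab, hx, -, tbx⟩, hmax⟩ := Set.exists_max_image P
    (fun p => (comp F (S \ {a, p.1}) p.2).ncard) (Set.toFinite P) hP
  dsimp only at hb hab hx tbx hmax
  set T := S \ {a, b}
  obtain ⟨y, hy, hyx, tay, tby⟩ : ∃ y ∈ T, y ∉ comp F T x ∧ Touches F {a} (comp F T y) ∧
      Touches F {b} (comp F T y) := by
    obtain ⟨x', hx', y', hy', hne, t1, t2, t3, t4⟩ :=
      hF.exists_two_components hab (hth b hb hab)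
    by_cases h1 : x' ∈ comp F T x
    · refine ⟨y', hy', fun h2 => hne ?_, t3, t4⟩
      rwa [comp_eq_of_mem hx h1]
    · exact ⟨x', hx', h1, t1, t2⟩
  obtain ⟨a', ha', b', hb', hab'⟩ := tay
  rw [Set.mem_singleton_iff.1 ha'] at hab'
  have hb'T := comp_subset hy hb'
  have hb'x : b' ∉ comp F T x := fun h => hyx (by
    rw [← comp_eq_of_mem hx h, comp_eq_of_mem hy hb']; exact mem_comp_self _ _)
  have hbT : b ∉ T := fun h => h.2 (.inr rfl)
  have hbb' : b ≠ b' := fun h => hbT (h ▸ hb'T)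
  have hbT' : b ∈ S \ {a, b'} := ⟨hb, by
    rintro (h | h)
    · exact hab.ne h.symm
    · exact hbb' h⟩
  have hcx : comp F T x ⊆ S \ {a, b'} := fun z hz => ⟨(comp_subset hx hz).1, by
    rintro (rfl | rfl)
    · exact (comp_subset hx hz).2 (.inl rfl)
    · exact hb'x hz⟩
  have hsub : comp F T x ⊆ comp F (S \ {a, b'}) b := by
    obtain ⟨p, hp, q, hq, hbq⟩ := tbx
    rw [Set.mem_singleton_iff.1 hp] at hbq
    exact (connOn_comp _ hx).subset_comp hcx hq
      (comp_closed (mem_comp_self _ _) hbq (hcx hq))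
  have htb' : Touches F {b'} (comp F (S \ {a, b'}) b) := by
    have hcon : ConnOn F (comp F T y ∪ {b}) := (connOn_comp _ hy).union (connOn_singleton b)
      tby.symm
    obtain ⟨q, hq, hqb⟩ := hcon.exists_adj_comp_diff (.inl hb') (.inr rfl) hbb'.symm
    refine ⟨b', rfl, q, comp_mono ?_ _ hq, hqb.symm⟩
    rintro w ⟨hw | rfl, hw'⟩
    · refine ⟨(comp_subset hy hw).1, ?_⟩
      rintro (rfl | rfl)
      · exact (comp_subset hy hw).2 (.inl rfl)
      · exact hw' rfl
    · exact hbT'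
  have hmem : (b', b) ∈ P :=
    ⟨hb'T.1, hab', hbT', ⟨a, rfl, b, mem_comp_self _ _, hab⟩, htb'⟩
  have hle := hmax _ hmem
  have hlt : (comp F T x).ncard < (comp F (S \ {a, b'}) b).ncard :=
    Set.ncard_lt_ncard ((Set.ssubset_iff_of_subset hsub).2
      ⟨b, mem_comp_self _ _, fun h => hbT (comp_subset hx h)⟩) (Set.toFinite _)
  exact absurd hle (not_le.2 hlt)

/-- Among the neighbours of `a` in the component of `b` in `S \ {a}`, `c` is the one whose deletion
leaves the smallest component around `b`. If another neighbour `n` remained there, minimality would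
keep `c` connected to `b` without `n`, and `{c}`, `{n}` would be the middle sets of a theta between
`a` and `b`. -/
theorem exists_separating_neighbor [Finite U] {S : Set U} {a b : U} (ha : a ∈ S) (hb : b ∈ S)
    (hne : a ≠ b) (hab : ¬ F.Adj a b) (hconn : a ∈ comp F S b) (hth : ¬ HasTheta F S a b) :
    ∃ c ∈ S, c ≠ a ∧ c ≠ b ∧ F.Adj a c ∧ Touches F {c} (comp F ((S \ {a}) \ {c}) b) ∧
      ∀ x ∈ comp F ((S \ {a}) \ {c}) b, ¬ F.Adj a x := by
  have hba : b ∈ S \ {a} := ⟨hb, hne.symm⟩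
  let N : Set U := {n | n ∈ comp F (S \ {a}) b ∧ F.Adj a n}
  have hNb : ∀ n ∈ N, n ≠ b := by
    rintro n ⟨-, h⟩ rfl
    exact hab h
  have hN : N.Nonempty := by
    obtain ⟨n, hn, hna⟩ := exists_adj_comp_diff hb hconn hne
    exact ⟨n, hn, hna.symm⟩
  obtain ⟨c, hc, hmin⟩ := Set.exists_min_image N
    (fun n => (comp F ((S \ {a}) \ {n}) b).ncard) (Set.toFinite N) hN
  have hcS : c ∈ S \ {a} := comp_subset hba hc.1
  have hbc : ∀ n ∈ N, b ∈ (S \ {a}) \ {n} := fun n hn => ⟨hba, (hNb n hn).symm⟩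
  refine ⟨c, hcS.1, hcS.2, hNb c hc, hc.2, ?_, fun n hn han => hth ?_⟩
  · obtain ⟨q, hq, hqc⟩ := exists_adj_comp_diff hba hc.1 (hNb c hc)
    exact ⟨c, rfl, q, hq, hqc.symm⟩
  have hnN : n ∈ N := ⟨comp_mono Set.sdiff_subset _ hn, han⟩
  have hnS := comp_subset (hbc c hc) hn
  have hcn : c ∈ comp F ((S \ {a}) \ {n}) b := by
    by_contra hcn
    have hsub : comp F ((S \ {a}) \ {n}) b ⊆ comp F ((S \ {a}) \ {c}) b := by
      refine (connOn_comp _ (hbc n hnN)).subset_comp (fun z hz => ?_) (mem_comp_self _ _)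
        (mem_comp_self _ _)
      refine ⟨(comp_subset (hbc n hnN) hz).1, ?_⟩
      rintro rfl
      exact hcn hz
    have hlt := Set.ncard_lt_ncard ((Set.ssubset_iff_of_subset hsub).2
      ⟨n, hn, fun h => (comp_subset (hbc n hnN) h).2 rfl⟩) (Set.toFinite _)
    exact absurd (hmin n hnN) (not_le.2 hlt)
  obtain ⟨p, hp, hpn⟩ := exists_adj_comp_diff (hbc c hc) hn (hNb n hnN)
  obtain ⟨q, hq, hqc⟩ := exists_adj_comp_diff (hbc n hnN) hcn (hNb c hc)
  rw [Set.sdiff_sdiff_comm] at hq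
  have hbB : b ∈ ((S \ {a}) \ {c}) \ {n} := ⟨hbc c hc, (hNb n hnN).symm⟩
  have hB := comp_subset (F := F) hbB
  refine ⟨{a}, comp F (((S \ {a}) \ {c}) \ {n}) b, {c}, {n},
    ⟨by simpa using ha, fun z hz => (hB hz).1.1.1, by simpa using hcS.1, by simpa using hnS.1.1⟩,
    ⟨connOn_singleton a, connOn_comp _ hbB, connOn_singleton c, connOn_singleton n⟩,
    ⟨?_, ?_, ?_, ?_, ?_, ?_⟩, ⟨rfl, mem_comp_self _ _⟩, ⟨a, rfl, c, rfl, hc.2⟩,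
    ⟨a, rfl, n, rfl, han⟩, ⟨q, hq, c, rfl, hqc⟩, ⟨p, hp, n, rfl, hpn⟩⟩
  · exact Set.disjoint_singleton_left.2 fun h => (hB h).1.1.2 rfl
  · exact Set.disjoint_singleton_left.2 fun h => hcS.2 h.symm
  · exact Set.disjoint_singleton_left.2 fun h => hnS.1.2 h.symm
  · exact Set.disjoint_singleton_right.2 fun h => (hB h).1.2 rfl
  · exact Set.disjoint_singleton_right.2 fun h => (hB h).2 rfl
  · exact Set.disjoint_singleton_left.2 fun h => hnS.2 h.symm

end Minors

/-! ### Homomorphism matrices under gluing. -/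

section Gluing

variable {V W : Type*} [Fintype V] [DecidableEq V] [Fintype W] [DecidableEq W]

theorem relHomMatrix_congr {U V : Type*} {E Q E' Q' : U → U → Prop} {G : SimpleGraph V}
    (h : ∀ f : U → V, RelHom E Q G f ↔ RelHom E' Q' G f) (a b : U) :
    relHomMatrix E Q G a b = relHomMatrix E' Q' G a b := by
  ext u v
  simp only [relHomMatrix, Matrix.of_apply, h]

/-- Presents a graph as a quotient along `π`, so that an induced subgraph can be rebuilt from two
overlapping pieces placed side by side. -/
theorem relHomMatrix_of_surjective {U U' V : Type*} {E : U → U → Prop} {E' Q' : U' → U' → Prop}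
    (G : SimpleGraph V) {π : U' → U} (hπ : Function.Surjective π)
    (hQ : ∀ x y, π x = π y → x = y ∨ Q' x y ∨ Q' y x) (hQ' : ∀ x y, Q' x y → π x = π y)
    (hE' : ∀ x y, E' x y → E (π x) (π y))
    (hE : ∀ p q, E p q → ∃ x y, π x = p ∧ π y = q ∧ E' x y) (a b : U') :
    relHomMatrix E (fun _ _ => False) G (π a) (π b) = relHomMatrix E' Q' G a b := by
  ext u v
  simp only [relHomMatrix, Matrix.of_apply]
  norm_cast
  have hfib : ∀ g : U' → V, RelHom E' Q' G g → ∀ x y, π x = π y → g x = g y := by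
    intro g hg x y hxy
    rcases hQ x y hxy with rfl | h | h
    · rfl
    · exact hg.2 _ _ h
    · exact (hg.2 _ _ h).symm
  have hinv : ∀ g : U' → V, RelHom E' Q' G g → ∀ x, g (Function.surjInv hπ (π x)) = g x :=
    fun g hg x => hfib g hg _ _ (Function.surjInv_eq hπ _)
  refine Nat.card_congr
    { toFun := fun f => ⟨f.1 ∘ π, ⟨fun x y h => f.2.1.1 _ _ (hE' x y h), fun x y h =>
        congrArg f.1 (hQ' x y h)⟩, f.2.2⟩
      invFun := fun g => ⟨g.1 ∘ Function.surjInv hπ, ⟨?_, fun _ _ h => h.elim⟩,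
        (hinv _ g.2.1 a).trans g.2.2.1, (hinv _ g.2.1 b).trans g.2.2.2⟩
      left_inv := fun f => Subtype.ext (funext fun x => congrArg f.1 (Function.surjInv_eq hπ x))
      right_inv := fun g => Subtype.ext (funext fun x => hinv _ g.2.1 x) }
  intro p q hpq
  obtain ⟨x, y, rfl, rfl, hxy⟩ := hE p q hpq
  simp only [Function.comp_apply, hinv _ g.2.1]
  exact g.2.1.1 _ _ hxy

theorem relHomMatrix_mul_ones_apply {U V : Type*} [Finite U] [Fintype V] (E Q : U → U → Prop)
    (G : SimpleGraph V) (a b : U) (u v : V) :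
    (relHomMatrix E Q G a b * onesMatrix V) u v =
      (Nat.card {f : U → V // RelHom E Q G f ∧ f a = u} : ℝ) := by
  simp only [Matrix.mul_apply, onesMatrix_apply, mul_one, relHomMatrix, Matrix.of_apply]
  norm_cast
  rw [← Nat.card_sigma]
  refine Nat.card_congr
    { toFun := fun z => ⟨z.2.1, z.2.2.1, z.2.2.2.1⟩
      invFun := fun f => ⟨f.1 b, f.1, f.2.1, f.2.2, rfl⟩
      left_inv := ?_
      right_inv := fun _ => rfl }
  rintro ⟨w, f, hf, hfa, hfb⟩
  subst hfb
  rfl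

/-- Moves both labels to `a`: the product with the all-ones matrix forgets the value at `b`, and the
diagonal is kept. -/
theorem relHomMatrix_self {U : Type*} [Finite U] (E Q : U → U → Prop) (G : SimpleGraph V)
    (a b : U) :
    relHomMatrix E Q G a a = 1 ⊙ (relHomMatrix E Q G a b * onesMatrix V) := by
  ext u v
  rw [Matrix.hadamard_apply, relHomMatrix_mul_ones_apply, Matrix.one_apply]
  simp only [relHomMatrix, Matrix.of_apply]
  split_ifs with h
  · subst h; rw [one_mul]; simp only [and_self]
  · have : IsEmpty {f : U → V // RelHom E Q G f ∧ f a = u ∧ f a = v} :=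
      ⟨fun ⟨f, _, hu, hv⟩ => h (hu.symm.trans hv)⟩
    simp

theorem relHomMatrix_disjoint {U U' : Type*} [Finite U] [Finite U'] (E Q : U → U → Prop)
    (E' Q' : U' → U' → Prop) (G : SimpleGraph V) (a : U) (b : U') :
    relHomMatrix (SeriesRel E E' fun _ _ => False) (SeriesRel Q Q' fun _ _ => False) G
      (.inl a) (.inr b) =
      relHomMatrix E Q G a a * onesMatrix V * relHomMatrix E' Q' G b b := by
  have key : ∀ u v, (relHomMatrix E Q G a a * onesMatrix V * relHomMatrix E' Q' G b b) u v =
      (Nat.card {f : U → V // RelHom E Q G f ∧ f a = u} : ℝ) *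
        Nat.card {f : U' → V // RelHom E' Q' G f ∧ f b = v} := by
    intro u v
    rw [Matrix.mul_apply]
    simp only [relHomMatrix_mul_ones_apply, ← Finset.mul_sum]
    congr 1
    rw [relHomMatrix_self E' Q' G b b]
    simp only [Matrix.hadamard_apply, relHomMatrix_mul_ones_apply, Matrix.one_apply, ite_mul,
      one_mul, zero_mul, Finset.sum_ite_eq', Finset.mem_univ, if_true]
  ext u v
  rw [key]
  simp only [relHomMatrix, Matrix.of_apply]
  norm_cast
  rw [← Nat.card_prod]
  refine Nat.card_congr
    { toFun := fun f => ⟨⟨f.1 ∘ Sum.inl, ⟨fun x y h => f.2.1.1 _ _ (.left h), fun x y h =>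
          f.2.1.2 _ _ (.left h)⟩, f.2.2.1⟩,
        ⟨f.1 ∘ Sum.inr, ⟨fun x y h => f.2.1.1 _ _ (.right h), fun x y h =>
          f.2.1.2 _ _ (.right h)⟩, f.2.2.2⟩⟩
      invFun := fun z => ⟨Sum.elim z.1.1 z.2.1, ⟨?_, ?_⟩, z.1.2.2, z.2.2.2⟩
      left_inv := fun f => Subtype.ext (Sum.elim_comp_inl_inr f.1)
      right_inv := fun _ => rfl }
  · rintro _ _ (h | h | h)
    · exact z.1.2.1.1 _ _ h
    · exact z.2.2.1.1 _ _ h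
    · exact h.elim
  · rintro _ _ (h | h | h)
    · exact z.1.2.1.2 _ _ h
    · exact z.2.2.1.2 _ _ h
    · exact h.elim

variable {U : Type*}

/-- The matrix counting the homomorphisms from the subgraph of `F` induced by `S` to `G`, by the
images of `a` and `b`. -/
noncomputable def homMatrix {V : Type*} (F : SimpleGraph U) (G : SimpleGraph V) (S : Set U)
    (a b : S) : Matrix V V ℝ :=
  relHomMatrix (fun x y : S => F.Adj x y) (fun _ _ => False) G a b

theorem homMatrix_series {V : Type*} [Fintype V] [Finite U] (F : SimpleGraph U)
    (G : SimpleGraph V) {S S₁ S₂ : Set U}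
    (h₁ : S₁ ⊆ S) (h₂ : S₂ ⊆ S) (hS : S ⊆ S₁ ∪ S₂) {c : U} (hc₁ : c ∈ S₁) (hc₂ : c ∈ S₂)
    (hc : ∀ x ∈ S₁, x ∈ S₂ → x = c)
    (hadj : ∀ x ∈ S, ∀ y ∈ S, F.Adj x y → (x ∈ S₁ ∧ y ∈ S₁) ∨ (x ∈ S₂ ∧ y ∈ S₂))
    {a b : U} (ha : a ∈ S₁) (hb : b ∈ S₂) :
    homMatrix F G S ⟨a, h₁ ha⟩ ⟨b, h₂ hb⟩ =
      homMatrix F G S₁ ⟨a, ha⟩ ⟨c, hc₁⟩ * homMatrix F G S₂ ⟨c, hc₂⟩ ⟨b, hb⟩ := by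
  rw [homMatrix, homMatrix, homMatrix, ← relHomMatrix_series]
  refine relHomMatrix_of_surjective (E := fun x y : S => F.Adj x y) G
    (π := Sum.elim (Set.inclusion h₁) (Set.inclusion h₂)) ?_ ?_ ?_ ?_ ?_
    (.inl ⟨a, ha⟩) (.inr ⟨b, hb⟩)
  · rintro ⟨x, hx⟩
    rcases hS hx with h | h
    · exact ⟨.inl ⟨x, h⟩, rfl⟩
    · exact ⟨.inr ⟨x, h⟩, rfl⟩
  · rintro (⟨x, hx⟩ | ⟨x, hx⟩) (⟨y, hy⟩ | ⟨y, hy⟩) hxy <;>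
      obtain rfl : x = y := congrArg Subtype.val hxy
    · exact .inl rfl
    · obtain rfl := hc x hx hy
      exact .inr (.inl (.join ⟨rfl, rfl⟩))
    · obtain rfl := hc x hy hx
      exact .inr (.inr (.join ⟨rfl, rfl⟩))
    · exact .inl rfl
  · rintro _ _ (h | h | ⟨rfl, rfl⟩)
    · exact h.elim
    · exact h.elim
    · rfl
  · rintro _ _ (h | h | h)
    · exact h
    · exact h
    · exact h.elim
  · rintro ⟨x, hx⟩ ⟨y, hy⟩ hxy
    rcases hadj x hx y hy hxy with ⟨h, h'⟩ | ⟨h, h'⟩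
    · exact ⟨.inl ⟨x, h⟩, .inl ⟨y, h'⟩, rfl, rfl, .left hxy⟩
    · exact ⟨.inr ⟨x, h⟩, .inr ⟨y, h'⟩, rfl, rfl, .right hxy⟩

theorem homMatrix_disjoint [Finite U] (F : SimpleGraph U) (G : SimpleGraph V) {S S₁ S₂ : Set U}
    (h₁ : S₁ ⊆ S) (h₂ : S₂ ⊆ S) (hS : S ⊆ S₁ ∪ S₂) (hd : Disjoint S₁ S₂)
    (hadj : ∀ x ∈ S, ∀ y ∈ S, F.Adj x y → (x ∈ S₁ ∧ y ∈ S₁) ∨ (x ∈ S₂ ∧ y ∈ S₂))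
    {a b : U} (ha : a ∈ S₁) (hb : b ∈ S₂) :
    homMatrix F G S ⟨a, h₁ ha⟩ ⟨b, h₂ hb⟩ =
      homMatrix F G S₁ ⟨a, ha⟩ ⟨a, ha⟩ * onesMatrix V * homMatrix F G S₂ ⟨b, hb⟩ ⟨b, hb⟩ := by
  rw [homMatrix, homMatrix, homMatrix, ← relHomMatrix_disjoint]
  refine relHomMatrix_of_surjective (E := fun x y : S => F.Adj x y) G
    (π := Sum.elim (Set.inclusion h₁) (Set.inclusion h₂)) ?_ ?_ ?_ ?_ ?_
    (.inl ⟨a, ha⟩) (.inr ⟨b, hb⟩)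
  · rintro ⟨x, hx⟩
    rcases hS hx with h | h
    · exact ⟨.inl ⟨x, h⟩, rfl⟩
    · exact ⟨.inr ⟨x, h⟩, rfl⟩
  · rintro (⟨x, hx⟩ | ⟨x, hx⟩) (⟨y, hy⟩ | ⟨y, hy⟩) hxy <;>
      obtain rfl : x = y := congrArg Subtype.val hxy
    · exact .inl rfl
    · exact absurd hy (Set.disjoint_left.1 hd hx)
    · exact absurd hx (Set.disjoint_left.1 hd hy)
    · exact .inl rfl
  · rintro _ _ (h | h | h) <;> exact h.elim
  · rintro _ _ (h | h | h)
    · exact h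
    · exact h
    · exact h.elim
  · rintro ⟨x, hx⟩ ⟨y, hy⟩ hxy
    rcases hadj x hx y hy hxy with ⟨h, h'⟩ | ⟨h, h'⟩
    · exact ⟨.inl ⟨x, h⟩, .inl ⟨y, h'⟩, rfl, rfl, .left hxy⟩
    · exact ⟨.inr ⟨x, h⟩, .inr ⟨y, h'⟩, rfl, rfl, .right hxy⟩

theorem homMatrix_of_adj {V : Type*} (F : SimpleGraph U) (G : SimpleGraph V)
    [DecidableRel G.Adj] {S : Set U} {a b : S} (hab : F.Adj a b) :
    homMatrix F G S a b =
      G.adjMatrix ℝ ⊙ homMatrix (F.deleteEdges {s(a.1, b.1)}) G S a b := by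
  rw [homMatrix, homMatrix, ← relHomMatrix_add_adj]
  refine relHomMatrix_congr (fun f => ?_) a b
  constructor
  · rintro ⟨hE, hQ⟩
    refine ⟨?_, hQ⟩
    rintro x y (h | ⟨rfl, rfl⟩)
    · exact hE x y (SimpleGraph.deleteEdges_le _ h)
    · exact hE _ _ hab
  · rintro ⟨hE, hQ⟩
    refine ⟨fun x y h => ?_, hQ⟩
    by_cases hxy : s(x.1, y.1) = s(a.1, b.1)
    · rcases Sym2.eq_iff.1 hxy with ⟨h1, h2⟩ | ⟨h1, h2⟩
      · exact hE x y (.inr ⟨Subtype.ext h1, Subtype.ext h2⟩)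
      · exact (hE y x (.inr ⟨Subtype.ext h2, Subtype.ext h1⟩)).symm
    · exact hE x y (.inl (SimpleGraph.deleteEdges_adj.2 ⟨h, hxy⟩))

theorem homMatrix_subsingleton {V : Type*} [DecidableEq V] (F : SimpleGraph U)
    (G : SimpleGraph V) {S : Set U} {a : S}
    (hS : ∀ x ∈ S, x = a.1) : homMatrix F G S a a = 1 ⊙ onesMatrix V := by
  have hu : ∀ x : S, x = a := fun x => Subtype.ext (hS x x.2)
  rw [one_hadamard_onesMatrix]
  ext u v
  simp only [homMatrix, relHomMatrix, Matrix.of_apply, Matrix.one_apply]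
  split_ifs with h
  · subst h
    norm_cast
    rw [Nat.card_eq_one_iff_unique]
    refine ⟨⟨fun f g => Subtype.ext (funext fun x => ?_)⟩, ⟨fun _ => u, ⟨?_, by simp⟩, rfl, rfl⟩⟩
    · rw [hu x]; exact f.2.2.1.trans g.2.2.1.symm
    · intro x y hxy
      rw [hu x, hu y] at hxy
      exact absurd hxy (F.loopless.irrefl _)
  · have : IsEmpty {f : S → V // RelHom (fun x y : S => F.Adj x y) (fun _ _ => False) G f ∧
        f a = u ∧ f a = v} := ⟨fun ⟨f, _, hu, hv⟩ => h (hu.symm.trans hv)⟩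
    simp

end Gluing

/-! ### Decomposing outerplanar graphs. -/

section Recursion

variable {V W : Type*} [Fintype V] [DecidableEq V] [Fintype W] [DecidableEq W]
  (G : SimpleGraph V) (H : SimpleGraph W) [DecidableRel G.Adj] [DecidableRel H.Adj]

theorem matrixPair_homMatrix {U : Type*} [Finite U] (n : ℕ) :
    ∀ (F : SimpleGraph U), IsOuterplanar F → ∀ S : Set U, S.ncard = n →
      (∀ a b : S, a ≠ b → ¬ HasTheta F S a b →
        MatrixPair G H (homMatrix F G S a b) (homMatrix F H S a b)) ∧
      ∀ a : S, MatrixPair G H (homMatrix F G S a a) (homMatrix F H S a a) := by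
  induction n using Nat.strong_induction_on with
  | _ n ih =>
  -- Nonadjacent labels come first and for every `F`, because removing the edge between adjacent
  -- labels does not shrink `S`.
  have hnonadj : ∀ (F : SimpleGraph U), IsOuterplanar F → ∀ S : Set U, S.ncard = n →
      ∀ a b : S, a ≠ b → ¬ HasTheta F S a b → ¬ F.Adj a b →
        MatrixPair G H (homMatrix F G S a b) (homMatrix F H S a b) := by
    rintro F hF S hSn ⟨a, ha⟩ ⟨b, hb⟩ hne hth hab
    have hne' : a ≠ b := fun h => hne (Subtype.ext h)
    have hlt : ∀ {S' : Set U} {x : U}, S' ⊆ S → x ∈ S → x ∉ S' → S'.ncard < n :=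
      fun hsub hx hx' => hSn ▸ Set.ncard_lt_ncard ((Set.ssubset_iff_of_subset hsub).2
        ⟨_, hx, hx'⟩) (Set.toFinite _)
    by_cases hconn : a ∈ comp F S b
    · obtain ⟨c, hcS, hca, hcb, hac, htc, hN⟩ :=
        exists_separating_neighbor ha hb hne' hab hconn hth
      have hbT : b ∈ (S \ {a}) \ {c} := ⟨⟨hb, hne'.symm⟩, hcb.symm⟩
      set Z := comp F ((S \ {a}) \ {c}) b with hZ
      have hZT : Z ⊆ (S \ {a}) \ {c} := comp_subset hbT
      have hZS : Z ⊆ S := fun z hz => (hZT hz).1.1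
      have hcZ : c ∉ Z := fun h => (hZT h).2 rfl
      have haZ : a ∉ Z := fun h => (hZT h).1.2 rfl
      have hbZ : b ∈ Z := mem_comp_self _ _
      have hZconn : ConnOn F Z := connOn_comp _ hbT
      have hleave : ∀ x ∈ Z, ∀ y ∈ S, F.Adj x y → y ∈ Z ∪ {c} := by
        intro x hx y hy hxy
        by_cases hyc : y = c
        · exact .inr hyc
        · refine .inl (comp_closed hx hxy ⟨⟨hy, ?_⟩, hyc⟩)
          rintro rfl
          exact hN x hx hxy.symm
      have h₁ : S \ Z ⊆ S := Set.sdiff_subset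
      have h₂ : Z ∪ {c} ⊆ S := Set.union_subset hZS (by simpa using hcS)
      have hcov : S ⊆ (S \ Z) ∪ (Z ∪ {c}) := fun x hx => by
        by_cases hxZ : x ∈ Z
        · exact .inr (.inl hxZ)
        · exact .inl ⟨hx, hxZ⟩
      have hint : ∀ x ∈ S \ Z, x ∈ Z ∪ {c} → x = c := fun x hx hx' => hx'.resolve_left hx.2
      have hadj : ∀ x ∈ S, ∀ y ∈ S, F.Adj x y →
          (x ∈ S \ Z ∧ y ∈ S \ Z) ∨ (x ∈ Z ∪ {c} ∧ y ∈ Z ∪ {c}) := by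
        intro x hx y hy hxy
        by_cases hxZ : x ∈ Z
        · exact .inr ⟨.inl hxZ, hleave x hxZ y hy hxy⟩
        · by_cases hyZ : y ∈ Z
          · exact .inr ⟨hleave y hyZ x hx hxy.symm, .inl hyZ⟩
          · exact .inl ⟨⟨hx, hxZ⟩, hy, hyZ⟩
      have ha₁ : a ∈ S \ Z := ⟨ha, haZ⟩
      have hc₁ : c ∈ S \ Z := ⟨hcS, hcZ⟩
      have hc₂ : c ∈ Z ∪ {c} := .inr rfl
      have hb₂ : b ∈ Z ∪ {c} := .inl hbZ
      have ha₂ : a ∉ Z ∪ {c} := fun h => h.elim haZ fun h => hca h.symm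
      -- A theta in either piece would extend to one between `a` and `b`: here `Z` is added to the
      -- set containing `c`, and in `hth₂` the vertex `a` is.
      have hth₁ : ¬ HasTheta F (S \ Z) a c := by
        rintro ⟨A, B, X, Y, ⟨sA, sB, sX, sY⟩, ⟨hA, hB, hX, hY⟩, ⟨dAB, dAX, dAY, dBX, dBY, dXY⟩,
          ⟨haA, hcB⟩, tAX, tAY, tBX, tBY⟩
        have hdZ : ∀ {A}, A ⊆ S \ Z → Disjoint A Z := fun h => (Set.subset_sdiff.1 h).2
        exact hth ⟨A, B ∪ Z, X, Y, ⟨sA.trans h₁, Set.union_subset (sB.trans h₁) hZS,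
          sX.trans h₁, sY.trans h₁⟩,
          ⟨hA, hB.union hZconn (htc.mono (by simpa using hcB) subset_rfl), hX, hY⟩,
          ⟨Set.disjoint_union_right.2 ⟨dAB, hdZ sA⟩, dAX, dAY,
            Set.disjoint_union_left.2 ⟨dBX, (hdZ sX).symm⟩,
            Set.disjoint_union_left.2 ⟨dBY, (hdZ sY).symm⟩, dXY⟩,
          ⟨haA, .inr hbZ⟩, tAX, tAY, tBX.mono Set.subset_union_left subset_rfl,
          tBY.mono Set.subset_union_left subset_rfl⟩
      have hth₂ : ¬ HasTheta F (Z ∪ {c}) c b := by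
        rintro ⟨A, B, X, Y, ⟨sA, sB, sX, sY⟩, ⟨hA, hB, hX, hY⟩, ⟨dAB, dAX, dAY, dBX, dBY, dXY⟩,
          ⟨hcA, hbB⟩, tAX, tAY, tBX, tBY⟩
        have hda : ∀ {A}, A ⊆ Z ∪ {c} → Disjoint {a} A := fun h =>
          Set.disjoint_singleton_left.2 fun h' => ha₂ (h h')
        exact hth ⟨A ∪ {a}, B, X, Y, ⟨Set.union_subset (sA.trans h₂) (by simpa using ha),
          sB.trans h₂, sX.trans h₂, sY.trans h₂⟩,
          ⟨hA.union (connOn_singleton a) ⟨c, hcA, a, rfl, hac.symm⟩, hB, hX, hY⟩,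
          ⟨Set.disjoint_union_left.2 ⟨dAB, hda sB⟩, Set.disjoint_union_left.2 ⟨dAX, hda sX⟩,
            Set.disjoint_union_left.2 ⟨dAY, hda sY⟩, dBX, dBY, dXY⟩,
          ⟨.inr rfl, hbB⟩, tAX.mono Set.subset_union_left subset_rfl,
          tAY.mono Set.subset_union_left subset_rfl, tBX, tBY⟩
      rw [homMatrix_series F G h₁ h₂ hcov hc₁ hc₂ hint hadj ha₁ hb₂,
        homMatrix_series F H h₁ h₂ hcov hc₁ hc₂ hint hadj ha₁ hb₂]
      refine .mul ?_ ?_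
      · exact (ih _ (hlt h₁ hb fun h => h.2 hbZ) F hF _ rfl).1 ⟨a, ha₁⟩ ⟨c, hc₁⟩
          (fun h => hca (congrArg Subtype.val h).symm) hth₁
      · exact (ih _ (hlt h₂ ha ha₂) F hF _ rfl).1 ⟨c, hc₂⟩ ⟨b, hb₂⟩
          (fun h => hcb (congrArg Subtype.val h)) hth₂
    · have hCS := comp_subset (F := F) hb
      have hbC : b ∈ comp F S b := mem_comp_self _ _
      have ha₁ : a ∈ S \ comp F S b := ⟨ha, hconn⟩
      have h₁ : S \ comp F S b ⊆ S := Set.sdiff_subset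
      have hcov : S ⊆ (S \ comp F S b) ∪ comp F S b := fun x hx => by
        by_cases hxZ : x ∈ comp F S b
        · exact .inr hxZ
        · exact .inl ⟨hx, hxZ⟩
      have hadj : ∀ x ∈ S, ∀ y ∈ S, F.Adj x y →
          (x ∈ S \ comp F S b ∧ y ∈ S \ comp F S b) ∨ (x ∈ comp F S b ∧ y ∈ comp F S b) := by
        intro x hx y hy hxy
        by_cases hxZ : x ∈ comp F S b
        · exact .inr ⟨hxZ, comp_closed hxZ hxy hy⟩
        · exact .inl ⟨⟨hx, hxZ⟩, hy, fun hyZ => hxZ (comp_closed hyZ hxy.symm hx)⟩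
      have hd : Disjoint (S \ comp F S b) (comp F S b) := Set.disjoint_sdiff_left
      rw [homMatrix_disjoint F G h₁ hCS hcov hd hadj ha₁ hbC,
        homMatrix_disjoint F H h₁ hCS hcov hd hadj ha₁ hbC]
      refine .mul (.mul ?_ .ones) ?_
      · exact (ih _ (hlt h₁ hb fun h => h.2 hbC) F hF _ rfl).2 ⟨a, ha₁⟩
      · exact (ih _ (hlt hCS ha hconn) F hF _ rfl).2 ⟨b, hbC⟩
  have hpair : ∀ (F : SimpleGraph U), IsOuterplanar F → ∀ S : Set U, S.ncard = n →
      ∀ a b : S, a ≠ b → ¬ HasTheta F S a b →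
        MatrixPair G H (homMatrix F G S a b) (homMatrix F H S a b) := by
    intro F hF S hSn a b hne hth
    by_cases hab : F.Adj a b
    · have hle : F.deleteEdges {s(a.1, b.1)} ≤ F := SimpleGraph.deleteEdges_le _
      rw [homMatrix_of_adj F G hab, homMatrix_of_adj F H hab]
      refine .hadamard_adjMatrix (hnonadj _ (hF.mono hle) S hSn a b hne
        (fun h => hth (h.mono_graph hle)) ?_)
      simp
    · exact hnonadj F hF S hSn a b hne hth hab
  intro F hF S hSn
  refine ⟨hpair F hF S hSn, fun a => ?_⟩
  -- A single label has its second label supplied by a partner without theta, which is then summed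
  -- out.
  by_cases hz : ∃ z ∈ S, z ≠ a.1
  · obtain ⟨z, hz, hza⟩ := hz
    obtain ⟨b, hb, hba, hth⟩ := hF.exists_not_hasTheta a.2 hz hza
    have hbne : a ≠ ⟨b, hb⟩ := fun h => hba (congrArg Subtype.val h).symm
    have := hpair F hF S hSn a ⟨b, hb⟩ hbne hth
    rw [homMatrix, homMatrix, relHomMatrix_self _ _ G a ⟨b, hb⟩,
      relHomMatrix_self _ _ H a ⟨b, hb⟩]
    exact (this.mul .ones).hadamard_one
  · push Not at hz
    rw [homMatrix_subsingleton F G hz, homMatrix_subsingleton F H hz]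
    exact MatrixPair.ones.hadamard_one

variable {G H}

theorem entrySum_homMatrix_univ {U V : Type*} [Finite U] [Fintype V] (F : SimpleGraph U)
    (G : SimpleGraph V)
    (a b : (Set.univ : Set U)) :
    entrySum (homMatrix F G Set.univ a b) = Nat.card (F →g G) := by
  rw [homMatrix, entrySum_relHomMatrix]
  norm_cast
  refine Nat.card_congr
    { toFun := fun f => ⟨fun x => f.1 ⟨x, trivial⟩, fun {x y} h => f.2.1 _ _ h⟩
      invFun := fun φ => ⟨fun x => φ x.1, fun x y h => φ.map_rel h, fun _ _ h => h.elim⟩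
      left_inv := fun _ => rfl
      right_inv := fun _ => rfl }

theorem card_hom_of_isEmpty {U V : Type*} [IsEmpty U] (F : SimpleGraph U) (G : SimpleGraph V) :
    Nat.card (F →g G) = 1 := by
  rw [Nat.card_eq_one_iff_unique]
  exact ⟨⟨fun f g => DFunLike.ext f g isEmptyElim⟩,
    ⟨⟨fun x => isEmptyElim x, fun {x} => isEmptyElim x⟩⟩⟩

theorem homIndistinguishable_of_entrySum_eq
    (hsum : ∀ X Y, MatrixPair G H X Y → entrySum X = entrySum Y) :
    HomIndistinguishable outerplanarGraphs G H := by
  intro U _ F hF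
  rcases isEmpty_or_nonempty U with hU | ⟨⟨a⟩⟩
  · rw [card_hom_of_isEmpty, card_hom_of_isEmpty]
  · have h := hsum _ _ ((matrixPair_homMatrix G H _ F hF Set.univ rfl).2 ⟨a, trivial⟩)
    rw [entrySum_homMatrix_univ, entrySum_homMatrix_univ] at h
    exact_mod_cast h

end Recursion

end LasserreIso

theorem theorem5 {V W : Type*} [Fintype V] [DecidableEq V] [Fintype W] [DecidableEq W]
    (G : SimpleGraph V) (H : SimpleGraph W) :
    LasserreIso.LasserreFeasible 1 G H ↔
      LasserreIso.HomIndistinguishable LasserreIso.outerplanarGraphs G H := by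
  classical
  exact ⟨fun h => LasserreIso.homIndistinguishable_of_entrySum_eq fun _ _ => h.entrySum_eq,
    fun h => LasserreIso.lasserreFeasible_of_entrySum_eq fun _ _ => h.entrySum_eq⟩
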